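/- Let $d>4$ be an integer and let $q>\frac{2d}{d-2}$ be real. There is a constant $C>0$, depending only on $d$ and $q$, such that the following holds. Let $\mu,\eta$ be Borel probability measures on $\mathbb{R}^d$ (with the Euclidean norm $|\cdot|$) with $$\chi_q(\mu):=\Big(\int_{\mathbb{R}^d}|u|^q\,\mu(\mathrm{d}u)\Big)^{1/q}<\infty .$$ Let $\widehat{\mathcal T}\subset L^2(\eta;\mathbb{R}^d)$ be a class of maps, let $T^\dagger\in L^2(\eta;\mathbb{R}^d)$ satisfy $T^\dagger\#\eta=\mu$, and let $\widehat T^\dagger\in\widehat{\mathcal T}$ be a best approximation, that is, a minimizer of $T\mapsto\|T-T^\dagger\|_{L^2(\eta)}$ over $\widehat{\mathcal T}$. Let $N\ge 1$, let $X_1,\dots,X_N$ be independent random variables with law $\mu$, and let $\mu^N=\frac1N\sum_{i=1}^N\delta_{X_i}$ be their empirical measure. For probability measures $\gamma,\gamma'$ on $\mathbb{R}^d$ with finite second moments, let $$\mathcal W_2(\gamma,\gamma')=\Big(\inf_{\pi}\int|u-u'|^2\,\pi(\mathrm{d}u,\mathrm{d}u')\Big)^{1/2},$$ the infimum being over all couplings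 $\pi$ of $\gamma$ and $\gamma'$ (and $\mathcal W_2(\gamma,\gamma')=\infty$ if one of the second moments is infinite). Then for every $\epsilon>0$ there is an event of probability at least $$1-\frac{C\,\chi_q(\mu)\,N^{-1/d}}{\epsilon}$$ on which every minimizer $\widehat T^N$ of $T\mapsto\mathcal W_2(T\#\eta,\mu^N)$ over $\widehat{\mathcal T}$ satisfies $$\mathcal W_2(\mu,\widehat T^N\#\eta)\le\|\widehat T^\dagger-T^\dagger\|_{L^2(\eta)}+\epsilon .$$ -/

import Mathlib

open MeasureTheory ProbabilityTheory
open scoped ENNReal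

noncomputable section

/-- The couplings `Π(γ, γ')`: probability measures on the product whose first and second
marginals are `γ` and `γ'`. -/
def couplings {E : Type*} [MeasurableSpace E] (γ γ' : Measure E) : Set (Measure (E × E)) :=
  {π | IsProbabilityMeasure π ∧ π.fst = γ ∧ π.snd = γ'}

/-- The `q`-th moment quantity `χ_q(μ) = (∫ ‖u‖ ^ q dμ) ^ (1 / q)`, with values in `[0, ∞]`. -/
def momentNorm {E : Type*} [NormedAddCommGroup E] [MeasurableSpace E] (q : ℝ)
    (μ : Measure E) : ℝ≥0∞ :=
  (∫⁻ u, ‖u‖ₑ ^ q ∂μ) ^ (1 / q)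

open Classical in
/-- The Wasserstein-`p` distance of two probability measures, with values in `[0, ∞]`; it is
`∞` by convention when one of the measures has no finite `p`-th moment. -/
def wasserstein {E : Type*} [NormedAddCommGroup E] [MeasurableSpace E] (p : ℝ)
    (γ γ' : Measure E) : ℝ≥0∞ :=
  if momentNorm p γ < ∞ ∧ momentNorm p γ' < ∞ then
    (⨅ π ∈ couplings γ γ', ∫⁻ z, ‖z.1 - z.2‖ₑ ^ p ∂π) ^ (1 / p)
  else ∞

/-- The empirical measure `(1 / N) ∑ δ_{x i}` of the points `x 0, …, x (N - 1)`. -/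
def empiricalMeas {E : Type*} [MeasurableSpace E] {N : ℕ} (x : Fin N → E) : Measure E :=
  (N : ℝ≥0∞)⁻¹ • ∑ i, Measure.dirac (x i)

/-- The set of minimizers of `J` over `S`. -/
def argminOn {α : Type*} (J : α → ℝ≥0∞) (S : Set α) : Set α :=
  {a | a ∈ S ∧ ∀ b ∈ S, J a ≤ J b}

end

/-! The statement splits into a deterministic stability estimate and a quantitative law of large
numbers for `μ^N`.

Stability (`wasserstein_argmin_le`): by the triangle inequality, replacing the target `μ` by `μ^N`
costs `W₂(μ, μ^N)` twice, once to pass from `μ` to `μ^N` and once to compare the minimizer with the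
competitor `TdagHat`. The distance from `TdagHat#η` to `μ = Tdag#η` is at most the `L²(η)` distance
of the maps. Hence it suffices that `W₂(μ, μ^N) ≤ ε / 2` with the stated probability.

Law of large numbers (`exists_wasserstein_majorant`): cut space into dyadic annuli of radius `R
2^n`, `R = χ_q(μ)`, and each annulus into nested dyadic cubes. Matching as much mass as possible in
the finest cubes, then the remainder in coarser ones, bounds the squared cost on an annulus by `(R
2^n)²` times a sum over scales `l` of `4^(-l)` times the cell discrepancies of `μ` and `μ^N`
(`exists_coupling_annular`). For an annulus of mass `m`, the variance bound and Cauchy-Schwarz over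
about `2^(dl)` cubes make the mean discrepancy at scale `l` at most of order `√(2^(dl) m / N)`. For
`d > 4` the sum is dominated by its finest scale, and stopping when `2^(dl)` is about `N m` gives `m
(N m)^(-2/d)` (`exists_depth_bound`). Since `m` is at most of order `2^(-qn)`, the sum over annuli
converges exactly because `q > 2d/(d-2)`. So `E W₂²` is at most of order `χ_q(μ)² N^(-2/d)`, and
Markov's inequality concludes. -/

/-! ### Wasserstein distance: gluing, triangle inequality, stability of minimizers -/

section Wasserstein

/-- Both couplings are disintegrated over the shared marginal `γ₂`, and the outer points are drawn
independently given the middle one. The middle point is the first coordinate of `ρ`. -/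
theorem exists_gluing {E : Type*} [MeasurableSpace E] [StandardBorelSpace E] [Nonempty E] {γ₁ γ₂ γ₃ : Measure E}
    {π₁ π₂ : Measure (E × E)}
    (h₁ : π₁ ∈ couplings γ₁ γ₂) (h₂ : π₂ ∈ couplings γ₂ γ₃) :
    ∃ ρ : Measure (E × E × E), ρ.map (fun z => (z.2.1, z.1)) = π₁ ∧
      ρ.map (fun z => (z.1, z.2.2)) = π₂ := by
  obtain ⟨hp₁, -, h₁⟩ := h₁
  obtain ⟨hp₂, h₂, -⟩ := h₂
  set σ := π₁.map Prod.swap with hσ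
  have hσp : IsProbabilityMeasure σ := Measure.isProbabilityMeasure_map (by fun_prop)
  have hσ1 : σ.fst = γ₂ := by rw [hσ, Measure.fst_map_swap, h₁]
  have hfin : IsProbabilityMeasure γ₂ := by rw [← hσ1]; infer_instance
  refine ⟨γ₂ ⊗ₘ (σ.condKernel ×ₖ π₂.condKernel), ?_, ?_⟩
  · have : (γ₂ ⊗ₘ (σ.condKernel ×ₖ π₂.condKernel)).map (Prod.map id Prod.fst) = σ := by
      rw [← Measure.compProd_map measurable_fst, ← Kernel.fst_eq, Kernel.fst_prod, ← hσ1,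
        Measure.disintegrate]
    have h2 : π₁ = σ.map Prod.swap := by
      rw [hσ, Measure.map_map measurable_swap measurable_swap]; simp
    calc _ = ((γ₂ ⊗ₘ (σ.condKernel ×ₖ π₂.condKernel)).map (Prod.map id Prod.fst)).map
          Prod.swap := by
          rw [Measure.map_map measurable_swap (by fun_prop)]
          rfl
      _ = π₁ := by rw [this, ← h2]
  · have : (γ₂ ⊗ₘ (σ.condKernel ×ₖ π₂.condKernel)).map (Prod.map id Prod.snd) = π₂ := by
      rw [← Measure.compProd_map measurable_snd, ← Kernel.snd_eq, Kernel.snd_prod, ← h₂,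
        Measure.disintegrate]
    exact this

theorem coupling_swap {E : Type*} [MeasurableSpace E] {γ γ' : Measure E} {π : Measure (E × E)}
    (hπ : π ∈ couplings γ γ') : π.map Prod.swap ∈ couplings γ' γ := by
  obtain ⟨h, h1, h2⟩ := hπ
  exact ⟨Measure.isProbabilityMeasure_map (by fun_prop), by rw [Measure.fst_map_swap, h2],
    by rw [Measure.snd_map_swap, h1]⟩

variable {E : Type*} [NormedAddCommGroup E] [MeasurableSpace E]

theorem wasserstein_le_of_coupling {p : ℝ} (hp : 0 < p) {γ γ' : Measure E}
    (hγ : momentNorm p γ < ∞) (hγ' : momentNorm p γ' < ∞) {π : Measure (E × E)}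
    (hπ : π ∈ couplings γ γ') :
    wasserstein p γ γ' ≤ (∫⁻ z, ‖z.1 - z.2‖ₑ ^ p ∂π) ^ (1 / p) := by
  rw [wasserstein, if_pos ⟨hγ, hγ'⟩]
  exact ENNReal.rpow_le_rpow (iInf₂_le π hπ) (by positivity)

theorem exists_coupling_of_wasserstein_lt {p : ℝ} (hp : 0 < p) {γ γ' : Measure E} {r : ℝ≥0∞}
    (h : wasserstein p γ γ' < r) :
    momentNorm p γ < ∞ ∧ momentNorm p γ' < ∞ ∧
      ∃ π ∈ couplings γ γ', (∫⁻ z, ‖z.1 - z.2‖ₑ ^ p ∂π) ^ (1 / p) < r := by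
  rw [wasserstein] at h
  split_ifs at h with hm
  · refine ⟨hm.1, hm.2, ?_⟩
    rw [one_div, ENNReal.rpow_inv_lt_iff hp] at h
    simp only [iInf_lt_iff] at h
    obtain ⟨π, hπ, h⟩ := h
    exact ⟨π, hπ, by rwa [one_div, ENNReal.rpow_inv_lt_iff hp]⟩
  · simp at h

variable [BorelSpace E] [SecondCountableTopology E]

theorem wasserstein_comm_le {p : ℝ} (hp : 0 < p) (γ γ' : Measure E) :
    wasserstein p γ γ' ≤ wasserstein p γ' γ := by
  refine le_of_forall_gt fun r hr => ?_
  obtain ⟨h1, h2, π, hπ, h⟩ := exists_coupling_of_wasserstein_lt hp hr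
  refine (wasserstein_le_of_coupling hp h2 h1 (coupling_swap hπ)).trans_lt ?_
  rw [lintegral_map (by fun_prop) measurable_swap]
  simpa [enorm_sub_rev] using h

theorem wasserstein_comm {p : ℝ} (hp : 0 < p) (γ γ' : Measure E) :
    wasserstein p γ γ' = wasserstein p γ' γ :=
  (wasserstein_comm_le hp γ γ').antisymm (wasserstein_comm_le hp γ' γ)

theorem wasserstein_triangle [CompleteSpace E] {p : ℝ} (hp : 1 ≤ p) (γ₁ γ₂ γ₃ : Measure E) :
    wasserstein p γ₁ γ₃ ≤ wasserstein p γ₁ γ₂ + wasserstein p γ₂ γ₃ := by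
  have hp0 : 0 < p := by linarith
  refine ENNReal.le_of_forall_pos_le_add fun ε hε hfin => ?_
  -- Near-optimal couplings, each with slack `ε / 2`, avoid having to show that the infimum is
  -- attained.
  have hε2 : (ε / 2 : ℝ≥0∞) ≠ 0 := by simpa using hε.ne'
  obtain ⟨hlt₁, hlt₂⟩ := ENNReal.add_lt_top.1 hfin
  obtain ⟨m₁, -, π₁, hπ₁, c₁⟩ :=
    exists_coupling_of_wasserstein_lt hp0 (ENNReal.lt_add_right hlt₁.ne hε2)
  obtain ⟨-, m₃, π₂, hπ₂, c₂⟩ :=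
    exists_coupling_of_wasserstein_lt hp0 (ENNReal.lt_add_right hlt₂.ne hε2)
  obtain ⟨ρ, hρ₁, hρ₂⟩ := exists_gluing hπ₁ hπ₂
  have hρp : IsProbabilityMeasure ρ := by
    have := hπ₁.1
    rw [← hρ₁] at this
    exact Measure.isProbabilityMeasure_of_map (f := fun z : E × E × E => (z.2.1, z.1))
  have hc : ρ.map (fun z => z.2) ∈ couplings γ₁ γ₃ := by
    refine ⟨Measure.isProbabilityMeasure_map (by fun_prop), ?_, ?_⟩
    · rw [← hπ₁.2.1, ← hρ₁, Measure.fst, Measure.fst, Measure.map_map (by fun_prop) (by fun_prop),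
        Measure.map_map (by fun_prop) (by fun_prop)]
      rfl
    · rw [← hπ₂.2.2, ← hρ₂, Measure.snd, Measure.snd, Measure.map_map (by fun_prop) (by fun_prop),
        Measure.map_map (by fun_prop) (by fun_prop)]
      rfl
  rw [← hρ₁, lintegral_map (by fun_prop) (by fun_prop)] at c₁
  rw [← hρ₂, lintegral_map (by fun_prop) (by fun_prop)] at c₂
  calc wasserstein p γ₁ γ₃ ≤ _ := wasserstein_le_of_coupling hp0 m₁ m₃ hc
    _ = (∫⁻ z, ‖z.2.1 - z.2.2‖ₑ ^ p ∂ρ) ^ (1 / p) := by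
      rw [lintegral_map (by fun_prop) (by fun_prop)]
    _ ≤ (∫⁻ z, (((fun z : E × E × E => ‖z.2.1 - z.1‖ₑ) + fun z : E × E × E => ‖z.1 - z.2.2‖ₑ) z) ^ p ∂ρ)
          ^ (1 / p) := by
      gcongr with z
      simpa using enorm_add_le (z.2.1 - z.1) (z.1 - z.2.2)
    _ ≤ _ := ENNReal.lintegral_Lp_add_le (by fun_prop) (by fun_prop) hp
    _ ≤ _ := add_le_add c₁.le c₂.le
    _ = _ := by
      rw [add_add_add_comm, ENNReal.add_halves]

theorem momentNorm_map_lt_top {η : Measure E} {T : E → E} (hT : MemLp T 2 η) :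
    momentNorm 2 (η.map T) < ∞ := by
  have := hT.2
  rw [eLpNorm_eq_lintegral_rpow_enorm_toReal (by simp) (by simp)] at this
  rw [momentNorm, lintegral_map' (by fun_prop) hT.1.aemeasurable]
  simpa using this

/-- The joint law of `(S, T)` under `η` is a competing coupling. -/
theorem wasserstein_map_le {η : Measure E} [IsProbabilityMeasure η] {S T : E → E}
    (hS : MemLp S 2 η) (hT : MemLp T 2 η) :
    wasserstein 2 (η.map S) (η.map T) ≤ eLpNorm (S - T) 2 η := by
  have hSm := hS.1.aemeasurable
  have hTm := hT.1.aemeasurable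
  have hc : η.map (fun x => (S x, T x)) ∈ couplings (η.map S) (η.map T) :=
    ⟨Measure.isProbabilityMeasure_map (hSm.prodMk hTm), Measure.fst_map_prodMk₀ hTm,
      Measure.snd_map_prodMk₀ hSm⟩
  refine (wasserstein_le_of_coupling two_pos (momentNorm_map_lt_top hS)
    (momentNorm_map_lt_top hT) hc).trans_eq ?_
  rw [lintegral_map' (by fun_prop) (hSm.prodMk hTm),
    eLpNorm_eq_lintegral_rpow_enorm_toReal (by simp) (by simp)]
  simp

/-- The error `δ` enters twice because `T₁` is compared with `T₀` through their distances to `ν`,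
not to `η.map S`. -/
theorem wasserstein_argmin_le [CompleteSpace E] {η ν : Measure E} [IsProbabilityMeasure η]
    {𝒯 : Set (E → E)} (h𝒯 : ∀ T ∈ 𝒯, MemLp T 2 η) {S T₀ T₁ : E → E} (hS : MemLp S 2 η)
    (hT₀ : T₀ ∈ 𝒯) (hT₁ : T₁ ∈ argminOn (fun T => wasserstein 2 (η.map T) ν) 𝒯) {δ : ℝ≥0∞}
    (hδ : wasserstein 2 (η.map S) ν ≤ δ) :
    wasserstein 2 (η.map S) (η.map T₁) ≤ eLpNorm (T₀ - S) 2 η + 2 * δ := by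
  have h12 : (1 : ℝ) ≤ 2 := by norm_num
  calc wasserstein 2 (η.map S) (η.map T₁)
      ≤ wasserstein 2 (η.map S) ν + wasserstein 2 ν (η.map T₁) := wasserstein_triangle h12 _ _ _
    _ ≤ wasserstein 2 (η.map S) ν + wasserstein 2 (η.map T₀) ν := by
      rw [wasserstein_comm two_pos ν]
      gcongr
      exact hT₁.2 _ hT₀
    _ ≤ wasserstein 2 (η.map S) ν
        + (wasserstein 2 (η.map T₀) (η.map S) + wasserstein 2 (η.map S) ν) := by
      gcongr
      exact wasserstein_triangle h12 _ _ _
    _ ≤ δ + (eLpNorm (T₀ - S) 2 η + δ) := by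
      gcongr
      exact wasserstein_map_le (h𝒯 _ hT₀) hS
    _ = _ := by ring

end Wasserstein

/-! ### Greedy matching of two measures along nested partitions -/

section Matching

/-- Keeping the proportion `b / max a b` of mass `a` keeps `min a b`, so the rest is the truncated
difference. If both vanish, `∞ * 0 = 0` makes the formula survive. -/
theorem ENNReal.one_sub_inv_max_mul {a b : ℝ≥0∞} (ha : a ≠ ∞) (hb : b ≠ ∞) :
    (1 - (max a b)⁻¹ * b) * a = a - b := by
  rcases le_total a b with h | h
  · rw [max_eq_right h, tsub_eq_zero_of_le h]
    rcases eq_or_ne b 0 with rfl | h0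
    · simp [le_antisymm h bot_le]
    · simp [ENNReal.inv_mul_cancel h0 hb]
  · rw [max_eq_left h]
    rcases eq_or_ne a 0 with rfl | h0
    · simp
    · rw [ENNReal.sub_mul (fun _ _ => ha), one_mul, mul_right_comm, ENNReal.inv_mul_cancel h0 ha,
        one_mul]

theorem ENNReal.inv_max_mul_le_one {a b : ℝ≥0∞} (hb : b ≠ ∞) : (max a b)⁻¹ * b ≤ 1 := by
  rcases eq_or_ne b 0 with rfl | h0
  · simp
  · calc (max a b)⁻¹ * b ≤ b⁻¹ * b := by gcongr; exact le_max_right _ _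
      _ = 1 := ENNReal.inv_mul_cancel h0 hb

variable {E ι : Type*} [MeasurableSpace E]

theorem isFiniteMeasure_of_fst {π : Measure (E × E)} (h : IsFiniteMeasure π.fst) :
    IsFiniteMeasure π := ⟨by rw [← Measure.fst_univ]; exact measure_lt_top _ _⟩

theorem measure_fst_preimage_eq_snd {κ : Type*} [MeasurableSpace κ] {π : Measure (E × E)}
    {g : E → κ} (hg : Measurable g) (h : ∀ᵐ z ∂π, g z.1 = g z.2) {s : Set κ}
    (hs : MeasurableSet s) : π.fst (g ⁻¹' s) = π.snd (g ⁻¹' s) := by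
  rw [Measure.fst_apply (hg hs), Measure.snd_apply (hg hs)]
  refine measure_congr ?_
  filter_upwards [h] with z hz
  simp only [eq_iff_iff]
  change g z.1 ∈ s ↔ g z.2 ∈ s
  rw [hz]

theorem measure_eq_sum_restrict_fiber [Countable ι] [MeasurableSpace ι]
    [MeasurableSingletonClass ι] (α : Measure E) {f : E → ι} (hf : Measurable f) :
    Measure.sum (fun i => α.restrict (f ⁻¹' {i})) = α := by
  rw [← Measure.restrict_iUnion (fun i j hij => ?_) fun i => hf (measurableSet_singleton i)]
  · rw [← Set.preimage_iUnion, Set.iUnion_of_singleton, Set.preimage_univ, Measure.restrict_univ]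
  · exact Disjoint.preimage f (by simpa using hij)

/-- The part of `α` that is not matched with `β` when, in each fibre of `f`, as much mass as possible
is matched. -/
noncomputable def unmatched [MeasurableSpace ι] (f : E → ι) (α β : Measure E) : Measure E :=
  Measure.sum fun i =>
    (1 - (max (α (f ⁻¹' {i})) (β (f ⁻¹' {i})))⁻¹ * β (f ⁻¹' {i})) • α.restrict (f ⁻¹' {i})

variable [MeasurableSpace ι] [MeasurableSingletonClass ι]

theorem unmatched_apply_fiber {f : E → ι} (hf : Measurable f) (α β : Measure E)
    [IsFiniteMeasure α] [IsFiniteMeasure β] (i : ι) :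
    unmatched f α β (f ⁻¹' {i}) = α (f ⁻¹' {i}) - β (f ⁻¹' {i}) := by
  have hm : ∀ i, MeasurableSet (f ⁻¹' {i}) := fun i => hf (measurableSet_singleton i)
  rw [unmatched, Measure.sum_apply _ (hm i), tsum_eq_single i]
  · simp only [Measure.smul_apply, Measure.restrict_apply (hm i), Set.inter_self, smul_eq_mul]
    exact ENNReal.one_sub_inv_max_mul (measure_ne_top _ _) (measure_ne_top _ _)
  · intro j hj
    have : f ⁻¹' {i} ∩ f ⁻¹' {j} = ∅ :=
      (Disjoint.preimage f (by simpa using hj.symm)).inter_eq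
    simp [Measure.restrict_apply (hm i), this]

variable [Countable ι]

theorem sum_smul_add_unmatched {f : E → ι} (hf : Measurable f) (α β : Measure E)
    [IsFiniteMeasure β] :
    Measure.sum (fun i => ((max (α (f ⁻¹' {i})) (β (f ⁻¹' {i})))⁻¹ * β (f ⁻¹' {i})) •
      α.restrict (f ⁻¹' {i})) + unmatched f α β = α := by
  rw [unmatched, Measure.sum_add_sum]
  conv_rhs => rw [← measure_eq_sum_restrict_fiber α hf]
  congr 1
  ext1 i
  rw [← add_smul, add_tsub_cancel_of_le (ENNReal.inv_max_mul_le_one (measure_ne_top _ _)), one_smul]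

/-- In each fibre, the product of the two restrictions divided by the larger of the two masses has
total mass equal to the smaller one, the most that can be matched there. -/
theorem exists_matching {f : E → ι} (hf : Measurable f) (α β : Measure E)
    [IsFiniteMeasure α] [IsFiniteMeasure β] :
    ∃ π : Measure (E × E), π.fst + unmatched f α β = α ∧ π.snd + unmatched f β α = β ∧
      ∀ᵐ z ∂π, f z.1 = f z.2 := by
  have hm : ∀ i, MeasurableSet (f ⁻¹' {i}) := fun i => hf (measurableSet_singleton i)
  refine ⟨Measure.sum fun i => (max (α (f ⁻¹' {i})) (β (f ⁻¹' {i})))⁻¹ •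
    (α.restrict (f ⁻¹' {i})).prod (β.restrict (f ⁻¹' {i})), ?_, ?_, ?_⟩
  · rw [Measure.fst, Measure.map_sum (by fun_prop)]
    convert sum_smul_add_unmatched hf α β using 4 with i
    rw [Measure.map_smul, Measure.map_fst_prod, smul_smul]
    simp
  · rw [Measure.snd, Measure.map_sum (by fun_prop)]
    convert sum_smul_add_unmatched hf β α using 4 with i
    rw [Measure.map_smul, Measure.map_snd_prod, smul_smul, max_comm]
    simp
  · rw [Measure.ae_sum_iff' (measurableSet_eq_fun (by fun_prop) (by fun_prop))]
    intro i
    refine Measure.ae_smul_measure ?_ _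
    rw [Measure.prod_restrict]
    filter_upwards [ae_restrict_mem ((hm i).prod (hm i))] with z hz
    exact hz.1.trans hz.2.symm

theorem measure_univ_eq_tsum_fiber (α : Measure E) {f : E → ι} (hf : Measurable f) :
    α Set.univ = ∑' i, α (f ⁻¹' {i}) := by
  conv_lhs => rw [← measure_eq_sum_restrict_fiber α hf]
  simp [Measure.sum_apply _ MeasurableSet.univ]

/-- Matching from the finest scale `L` to the coarsest scale `0`. -/
theorem exists_multiscale_matching {f : ℕ → E → ι} (hf : ∀ l, Measurable (f l))
    (hfc : ∀ l x y, f (l + 1) x = f (l + 1) y → f l x = f l y) {c : E × E → ℝ≥0∞} {D : ℕ → ℝ≥0∞}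
    (hc : ∀ l z, f l z.1 = f l z.2 → c z ≤ D l) (L : ℕ) (α β : Measure E)
    [IsFiniteMeasure α] [IsFiniteMeasure β] :
    ∃ (π : Measure (E × E)) (α' β' : Measure E), π.fst + α' = α ∧ π.snd + β' = β ∧
      (∀ i, α' (f 0 ⁻¹' {i}) = α (f 0 ⁻¹' {i}) - β (f 0 ⁻¹' {i})) ∧
      (∀ i, β' (f 0 ⁻¹' {i}) = β (f 0 ⁻¹' {i}) - α (f 0 ⁻¹' {i})) ∧
      ∫⁻ z, c z ∂π ≤ D L * α Set.univ + ∑ l ∈ Finset.range L,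
        D l * ∑' i, (α (f (l + 1) ⁻¹' {i}) - β (f (l + 1) ⁻¹' {i})) := by
  induction L generalizing α β with
  | zero =>
    obtain ⟨π, h1, h2, h3⟩ := exists_matching (hf 0) α β
    refine ⟨π, _, _, h1, h2, unmatched_apply_fiber (hf 0) α β, unmatched_apply_fiber (hf 0) β α, ?_⟩
    calc ∫⁻ z, c z ∂π ≤ ∫⁻ z, D 0 ∂π := lintegral_mono_ae (h3.mono fun z hz => hc 0 z hz)
      _ = D 0 * π.fst Set.univ := by simp [Measure.fst_univ]
      _ ≤ D 0 * α Set.univ := by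
        gcongr
        rw [← h1]
        exact Measure.le_add_right le_rfl
      _ = _ := by simp
  | succ L ih =>
    obtain ⟨π, h1, h2, h3⟩ := exists_matching (hf (L + 1)) α β
    set α₁ := unmatched (f (L + 1)) α β with hα₁
    set β₁ := unmatched (f (L + 1)) β α with hβ₁
    have hle1 : α₁ ≤ α := by conv_rhs => rw [← h1]
                             exact Measure.le_add_left le_rfl
    have hle2 : β₁ ≤ β := by conv_rhs => rw [← h2]
                             exact Measure.le_add_left le_rfl
    have hle3 : π.fst ≤ α := by conv_rhs => rw [← h1]
                                exact Measure.le_add_right le_rfl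
    have := isFiniteMeasure_of_le α hle1
    have := isFiniteMeasure_of_le β hle2
    have := isFiniteMeasure_of_fst (isFiniteMeasure_of_le α hle3)
    have hcoarse : ∀ l, l ≤ L + 1 → ∀ x y, f (L + 1) x = f (L + 1) y → f l x = f l y := by
      intro l hl
      obtain ⟨k, hk⟩ := Nat.exists_eq_add_of_le hl
      clear hl
      induction k generalizing l with
      | zero => exact fun x y h => by rwa [hk] at h
      | succ k ih' => exact fun x y h => hfc l x y (ih' (l + 1) (by omega) x y h)
    -- Pairs matched at scale `L + 1` share their cell at every coarser scale, so removing them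
    -- subtracts the same mass from both measures in each coarse cell.
    have hdiff : ∀ l ≤ L + 1, ∀ i, α (f l ⁻¹' {i}) - β (f l ⁻¹' {i})
        = α₁ (f l ⁻¹' {i}) - β₁ (f l ⁻¹' {i}) ∧ β (f l ⁻¹' {i}) - α (f l ⁻¹' {i})
        = β₁ (f l ⁻¹' {i}) - α₁ (f l ⁻¹' {i}) := by
      intro l hl i
      have he := measure_fst_preimage_eq_snd (hf l) (h3.mono fun z => hcoarse l hl _ _)
        (measurableSet_singleton i)
      rw [← h1, ← h2, Measure.add_apply, Measure.add_apply, he]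
      rw [ENNReal.add_sub_add_eq_sub_left (measure_ne_top _ _),
        ENNReal.add_sub_add_eq_sub_left (measure_ne_top _ _)]
      exact ⟨rfl, rfl⟩
    obtain ⟨π', α', β', k1, k2, k3, k4, k5⟩ := ih α₁ β₁
    refine ⟨π + π', α', β', ?_, ?_, fun i => ?_, fun i => ?_, ?_⟩
    · rw [Measure.fst_add, add_assoc, k1, h1]
    · rw [Measure.snd_add, add_assoc, k2, h2]
    · rw [k3, (hdiff 0 (by omega) i).1]
    · rw [k4, (hdiff 0 (by omega) i).2]
    · rw [lintegral_add_measure, Finset.sum_range_succ, add_comm (∑ l ∈ _, _), ← add_assoc]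
      have e1 : ∫⁻ z, c z ∂π ≤ D (L + 1) * α Set.univ := by
        calc ∫⁻ z, c z ∂π ≤ ∫⁻ z, D (L + 1) ∂π :=
              lintegral_mono_ae (h3.mono fun z hz => hc _ z hz)
          _ = D (L + 1) * π.fst Set.univ := by simp [Measure.fst_univ]
          _ ≤ D (L + 1) * α Set.univ := by gcongr
      -- The mass left over at scale `L + 1` is exactly the one-sided discrepancy there; it is what
      -- the next matching moves at cost `D L`.
      have e2 : α₁ Set.univ = ∑' i, (α (f (L + 1) ⁻¹' {i}) - β (f (L + 1) ⁻¹' {i})) := by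
        rw [measure_univ_eq_tsum_fiber α₁ (hf (L + 1))]
        exact tsum_congr fun i => unmatched_apply_fiber (hf (L + 1)) α β i
      rw [← e2, add_assoc]
      refine add_le_add e1 (k5.trans_eq ?_)
      congr 1
      refine Finset.sum_congr rfl fun l hl => ?_
      have := Finset.mem_range.1 hl
      congr 1
      exact tsum_congr fun i => ((hdiff (l + 1) (by omega) i).1).symm

end Matching

/-! ### Coupling assembled from matchings on annuli -/

section AnnularCoupling

theorem exists_marginals_eq {E : Type*} [MeasurableSpace E] (α β : Measure E) [IsFiniteMeasure α]
    [IsFiniteMeasure β] (h : α Set.univ = β Set.univ) :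
    ∃ π : Measure (E × E), π.fst = α ∧ π.snd = β := by
  rcases eq_or_ne (α Set.univ) 0 with h0 | h0
  · refine ⟨0, ?_, ?_⟩
    · rw [Measure.fst_zero]
      exact (Measure.measure_univ_eq_zero.1 h0).symm
    · rw [Measure.snd_zero]
      exact (Measure.measure_univ_eq_zero.1 (h ▸ h0)).symm
  · have hi : (α Set.univ)⁻¹ * α Set.univ = 1 := ENNReal.inv_mul_cancel h0 (measure_ne_top _ _)
    refine ⟨(α Set.univ)⁻¹ • α.prod β, ?_, ?_⟩
    · rw [Measure.fst, Measure.map_smul, Measure.map_fst_prod, smul_smul, ← h, hi, one_smul]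
    · rw [Measure.snd, Measure.map_smul, Measure.map_snd_prod, smul_smul, hi, one_smul]

/-- The distance `|a - b|` of two extended nonnegative reals. -/
noncomputable def absDiff (a b : ℝ≥0∞) : ℝ≥0∞ := (a - b) + (b - a)

/-- The total discrepancy of `α` and `β` over the parts into which the fibres of `g` cut `s`. -/
noncomputable def fiberDiff {E ι : Type*} [MeasurableSpace E] (α β : Measure E) (s : Set E)
    (g : E → ι) : ℝ≥0∞ :=
  ∑' i, absDiff (α (s ∩ g ⁻¹' {i})) (β (s ∩ g ⁻¹' {i}))

/-- The weighted sum over the scales `0, …, L` of the discrepancies of `α` and `β` on `s`. -/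
noncomputable def multiscaleDiff {E ι : Type*} [MeasurableSpace E] (α β : Measure E) (s : Set E)
    (f : ℕ → E → ι) (L : ℕ) : ℝ≥0∞ :=
  (4⁻¹ : ℝ≥0∞) ^ L * α s + ∑ l ∈ Finset.range (L + 1), (4⁻¹ : ℝ≥0∞) ^ l * fiberDiff α β s (f l)

theorem enorm_sub_sq_le {E : Type*} [NormedAddCommGroup E] (x y : E) :
    ‖x - y‖ₑ ^ 2 ≤ 2 * ‖x‖ₑ ^ 2 + 2 * ‖y‖ₑ ^ 2 := by
  have h : ‖x - y‖ ^ 2 ≤ 2 * ‖x‖ ^ 2 + 2 * ‖y‖ ^ 2 := by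
    nlinarith [norm_sub_le x y, norm_nonneg (x - y), sq_nonneg (‖x‖ - ‖y‖), norm_nonneg x,
      norm_nonneg y]
  simp only [← ofReal_norm, ← ENNReal.ofReal_pow (norm_nonneg _)]
  rw [show (2 : ℝ≥0∞) = ENNReal.ofReal 2 by simp, ← ENNReal.ofReal_mul (by norm_num),
    ← ENNReal.ofReal_mul (by norm_num), ← ENNReal.ofReal_add (by positivity) (by positivity)]
  exact ENNReal.ofReal_le_ofReal h

variable {E : Type*} [NormedAddCommGroup E] [MeasurableSpace E]

/-- The second moments of the remainders `α'`, `β'` are charged here because that mass will later be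
coupled arbitrarily. On `s` they are at most `r ^ 2` times the scale-`0` discrepancy, which supplies
the `l = 0` term of `multiscaleDiff`. -/
theorem exists_matching_on {ι : Type*} [Countable ι] [MeasurableSpace ι]
    [MeasurableSingletonClass ι] {f : ℕ → E → ι} (hf : ∀ l, Measurable (f l))
    (hfc : ∀ l x y, f (l + 1) x = f (l + 1) y → f l x = f l y) {r K : ℝ≥0∞}
    (hc : ∀ l x y, f l x = f l y → ‖x - y‖ₑ ^ 2 ≤ K * r ^ 2 * 4⁻¹ ^ l) (hK : 1 ≤ K)
    {s : Set E} (hs : MeasurableSet s) (hr : ∀ x ∈ s, ‖x‖ₑ ≤ r) (L : ℕ) (α β : Measure E)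
    [IsFiniteMeasure α] [IsFiniteMeasure β] :
    ∃ (π : Measure (E × E)) (α' β' : Measure E),
      π.fst + α' = α.restrict s ∧ π.snd + β' = β.restrict s ∧
      ∫⁻ z, ‖z.1 - z.2‖ₑ ^ 2 ∂π + 2 * ∫⁻ x, ‖x‖ₑ ^ 2 ∂α' + 2 * ∫⁻ x, ‖x‖ₑ ^ 2 ∂β' ≤
        4 * K * (r ^ 2 * multiscaleDiff α β s f L) := by
  obtain ⟨π, α', β', h1, h2, h3, h4, h5⟩ := exists_multiscale_matching hf hfc
    (c := fun z => ‖z.1 - z.2‖ₑ ^ 2) (D := fun l => K * r ^ 2 * 4⁻¹ ^ l)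
    (fun l z => hc l z.1 z.2) L (α.restrict s) (β.restrict s)
  refine ⟨π, α', β', h1, h2, ?_⟩
  have hmass : ∀ {γ γ' : Measure E} {ρ : Measure E}, ρ + γ' = γ.restrict s →
      ∫⁻ x, ‖x‖ₑ ^ 2 ∂γ' ≤ r ^ 2 * ∑' i, γ' (f 0 ⁻¹' {i}) := by
    intro γ γ' ρ h
    have hle : γ' ≤ γ.restrict s := by rw [← h]; exact Measure.le_add_left le_rfl
    have hae : ∀ᵐ x ∂γ', ‖x‖ₑ ^ 2 ≤ r ^ 2 := by
      refine (Measure.absolutelyContinuous_of_le hle).ae_le ?_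
      filter_upwards [ae_restrict_mem hs] with x hx
      gcongr
      exact hr x hx
    refine (lintegral_mono_ae hae).trans_eq ?_
    rw [lintegral_const, measure_univ_eq_tsum_fiber γ' (hf 0)]
  have hrestr : ∀ (γ : Measure E) l i, γ.restrict s (f l ⁻¹' {i}) = γ (s ∩ f l ⁻¹' {i}) := by
    intro γ l i
    rw [Measure.restrict_apply (hf l (measurableSet_singleton i)), Set.inter_comm]
  have m1 := hmass h1
  have m2 := hmass h2
  simp only [h3, h4, hrestr] at m1 m2
  simp only [hrestr, Measure.restrict_apply_univ] at h5
  have h6 : ∫⁻ x, ‖x‖ₑ ^ 2 ∂α' + ∫⁻ x, ‖x‖ₑ ^ 2 ∂β' ≤ r ^ 2 * fiberDiff α β s (f 0) := by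
    simp only [fiberDiff, absDiff]
    rw [ENNReal.tsum_add, mul_add]
    exact add_le_add m1 m2
  have h7 : ∫⁻ z, ‖z.1 - z.2‖ₑ ^ 2 ∂π ≤ 4 * K * r ^ 2 * (4⁻¹ ^ L * α s) +
      4 * K * r ^ 2 * ∑ l ∈ Finset.range L, 4⁻¹ ^ (l + 1) * fiberDiff α β s (f (l + 1)) := by
    refine h5.trans (add_le_add ?_ ?_)
    · calc K * r ^ 2 * 4⁻¹ ^ L * α s = 1 * K * r ^ 2 * (4⁻¹ ^ L * α s) := by ring
        _ ≤ _ := by gcongr; norm_num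
    · rw [Finset.mul_sum]
      refine Finset.sum_le_sum fun l _ => ?_
      -- The discrepancy at scale `l + 1` is paid at the diameter of scale `l`; this shift is the
      -- source of the factor `4`.
      have h4 : (4 : ℝ≥0∞) * 4⁻¹ = 1 := ENNReal.mul_inv_cancel (by norm_num) (by norm_num)
      calc _ ≤ K * r ^ 2 * 4⁻¹ ^ l * fiberDiff α β s (f (l + 1)) := by
            gcongr
            rw [fiberDiff]
            exact ENNReal.tsum_le_tsum fun i => le_self_add (α := ℝ≥0∞)
        _ = (4 * 4⁻¹) * (K * r ^ 2 * 4⁻¹ ^ l * fiberDiff α β s (f (l + 1))) := by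
            rw [h4, one_mul]
        _ = _ := by ring
  calc _ = ∫⁻ z, ‖z.1 - z.2‖ₑ ^ 2 ∂π + 2 * (∫⁻ x, ‖x‖ₑ ^ 2 ∂α' + ∫⁻ x, ‖x‖ₑ ^ 2 ∂β') := by ring
    _ ≤ (4 * K * r ^ 2 * (4⁻¹ ^ L * α s) +
      4 * K * r ^ 2 * ∑ l ∈ Finset.range L, 4⁻¹ ^ (l + 1) * fiberDiff α β s (f (l + 1))) +
      4 * K * (r ^ 2 * fiberDiff α β s (f 0)) := by
        gcongr
        · calc (2 : ℝ≥0∞) ≤ 4 * 1 := by norm_num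
            _ ≤ 4 * K := by gcongr
    _ = _ := by
        rw [multiscaleDiff, Finset.sum_range_succ']
        ring

variable [BorelSpace E] [SecondCountableTopology E]

/-- Within an annulus the two masses may differ, so each matching leaves a remainder. The remainders
balance in total and are coupled across annuli by a normalized product measure. -/
theorem exists_coupling_annular {ι : Type*} [Countable ι] [MeasurableSpace ι]
    [MeasurableSingletonClass ι] {f : ℕ → ℕ → E → ι} (hf : ∀ n l, Measurable (f n l))
    (hfc : ∀ n l x y, f n (l + 1) x = f n (l + 1) y → f n l x = f n l y) {r : ℕ → ℝ≥0∞} {K : ℝ≥0∞}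
    (hc : ∀ n l x y, f n l x = f n l y → ‖x - y‖ₑ ^ 2 ≤ K * r n ^ 2 * 4⁻¹ ^ l) (hK : 1 ≤ K)
    {s : ℕ → Set E} (hs : ∀ n, MeasurableSet (s n)) (hsd : Pairwise (Function.onFun Disjoint s))
    (hsu : ⋃ n, s n = Set.univ) (hr : ∀ n, ∀ x ∈ s n, ‖x‖ₑ ≤ r n) (L : ℕ → ℕ) (α β : Measure E)
    [IsProbabilityMeasure α] [IsProbabilityMeasure β] :
    ∃ π ∈ couplings α β, ∫⁻ z, ‖z.1 - z.2‖ₑ ^ 2 ∂π ≤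
      4 * K * ∑' n, r n ^ 2 * multiscaleDiff α β (s n) (f n) (L n) := by
  choose π α' β' h1 h2 h3 using fun n =>
    exists_matching_on (hf n) (hfc n) (hc n) hK (hs n) (hr n) (L n) α β
  have hsum : ∀ γ : Measure E, Measure.sum (fun n => γ.restrict (s n)) = γ := fun γ => by
    rw [← Measure.restrict_iUnion hsd hs, hsu, Measure.restrict_univ]
  have hα : (Measure.sum π).fst + Measure.sum α' = α := by
    rw [Measure.fst, Measure.map_sum (by fun_prop), Measure.sum_add_sum]
    exact (congrArg Measure.sum (funext h1)).trans (hsum α)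
  have hβ : (Measure.sum π).snd + Measure.sum β' = β := by
    rw [Measure.snd, Measure.map_sum (by fun_prop), Measure.sum_add_sum]
    exact (congrArg Measure.sum (funext h2)).trans (hsum β)
  have hα' : Measure.sum α' ≤ α := by
    conv_rhs => rw [← hα]
    exact Measure.le_add_left le_rfl
  have hβ' : Measure.sum β' ≤ β := by
    conv_rhs => rw [← hβ]
    exact Measure.le_add_left le_rfl
  have hπ : (Measure.sum π).fst ≤ α := by
    conv_rhs => rw [← hα]
    exact Measure.le_add_right le_rfl
  have := isFiniteMeasure_of_le α hα'
  have := isFiniteMeasure_of_le β hβ'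
  have := isFiniteMeasure_of_fst (isFiniteMeasure_of_le α hπ)
  have hmass : Measure.sum α' Set.univ = Measure.sum β' Set.univ := by
    have e1 : (Measure.sum π).fst Set.univ + Measure.sum α' Set.univ
        = (Measure.sum π).snd Set.univ + Measure.sum β' Set.univ := by
      rw [← Measure.add_apply, ← Measure.add_apply, hα, hβ, measure_univ, measure_univ]
    rw [Measure.fst_univ, Measure.snd_univ] at e1
    exact (ENNReal.add_right_inj (measure_ne_top _ _)).1 e1
  obtain ⟨ρ, hρ1, hρ2⟩ := exists_marginals_eq _ _ hmass
  have c1 : (Measure.sum π + ρ).fst = α := by rw [Measure.fst_add, hρ1, hα]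
  have c2 : (Measure.sum π + ρ).snd = β := by rw [Measure.snd_add, hρ2, hβ]
  refine ⟨Measure.sum π + ρ, ⟨⟨by rw [← Measure.fst_univ, c1, measure_univ]⟩, c1, c2⟩, ?_⟩
  -- Only the marginals of `ρ` matter, through `|x - y|² ≤ 2|x|² + 2|y|²`.
  have hρ : ∫⁻ z, ‖z.1 - z.2‖ₑ ^ 2 ∂ρ
      ≤ ∑' n, 2 * ∫⁻ x, ‖x‖ₑ ^ 2 ∂(α' n) + ∑' n, 2 * ∫⁻ x, ‖x‖ₑ ^ 2 ∂(β' n) := by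
    calc ∫⁻ z, ‖z.1 - z.2‖ₑ ^ 2 ∂ρ ≤ ∫⁻ z, (2 * ‖z.1‖ₑ ^ 2 + 2 * ‖z.2‖ₑ ^ 2) ∂ρ :=
          lintegral_mono fun z => enorm_sub_sq_le _ _
      _ = 2 * ∫⁻ z, ‖z.1‖ₑ ^ 2 ∂ρ + 2 * ∫⁻ z, ‖z.2‖ₑ ^ 2 ∂ρ := by
          rw [lintegral_add_left (by fun_prop), lintegral_const_mul _ (by fun_prop),
            lintegral_const_mul _ (by fun_prop)]
      _ = 2 * ∫⁻ x, ‖x‖ₑ ^ 2 ∂ρ.fst + 2 * ∫⁻ x, ‖x‖ₑ ^ 2 ∂ρ.snd := by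
          rw [Measure.fst, Measure.snd, lintegral_map (by fun_prop) (by fun_prop),
            lintegral_map (by fun_prop) (by fun_prop)]
      _ = _ := by
          rw [hρ1, hρ2, lintegral_sum_measure, lintegral_sum_measure, ENNReal.tsum_mul_left,
            ENNReal.tsum_mul_left]
  rw [lintegral_add_measure, lintegral_sum_measure]
  calc _ ≤ ∑' n, ∫⁻ z, ‖z.1 - z.2‖ₑ ^ 2 ∂(π n) +
        (∑' n, 2 * ∫⁻ x, ‖x‖ₑ ^ 2 ∂(α' n) + ∑' n, 2 * ∫⁻ x, ‖x‖ₑ ^ 2 ∂(β' n)) := by gcongr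
    _ = ∑' n, (∫⁻ z, ‖z.1 - z.2‖ₑ ^ 2 ∂(π n) + 2 * ∫⁻ x, ‖x‖ₑ ^ 2 ∂(α' n) +
        2 * ∫⁻ x, ‖x‖ₑ ^ 2 ∂(β' n)) := by
        rw [ENNReal.tsum_add, ENNReal.tsum_add, add_assoc]
    _ ≤ ∑' n, 4 * K * (r n ^ 2 * multiscaleDiff α β (s n) (f n) (L n)) :=
        ENNReal.tsum_le_tsum h3
    _ = _ := ENNReal.tsum_mul_left

end AnnularCoupling

/-! ### Dyadic cubes: nesting, diameter and counting -/

section DyadicCells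

variable {d : ℕ}

/-- The index of the cube of side `r / 2 ^ l` that contains a point. -/
noncomputable def dyadicIndex (r : ℝ) (l : ℕ) (x : EuclideanSpace ℝ (Fin d)) : Fin d → ℤ :=
  fun i => ⌊x i / r * 2 ^ l⌋

theorem measurable_dyadicIndex (r : ℝ) (l : ℕ) :
    Measurable (dyadicIndex r l : EuclideanSpace ℝ (Fin d) → Fin d → ℤ) := by
  refine measurable_pi_lambda _ fun i => Int.measurable_floor.comp ?_
  fun_prop

theorem dyadicIndex_coarsen (r : ℝ) (l : ℕ) (x y : EuclideanSpace ℝ (Fin d))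
    (h : dyadicIndex r (l + 1) x = dyadicIndex r (l + 1) y) :
    dyadicIndex r l x = dyadicIndex r l y := by
  have key : ∀ t : ℝ, ⌊t * 2 ^ l⌋ = ⌊t * 2 ^ (l + 1)⌋ / 2 := by
    intro t
    have := Int.floor_div_natCast (t * 2 ^ (l + 1)) 2
    rw [← Nat.cast_ofNat (R := ℤ), ← this]
    congr 1
    push_cast
    ring
  ext i
  have := congrFun h i
  simp only [dyadicIndex] at this ⊢
  rw [key, this, ← key]

theorem enorm_sub_sq_le_of_dyadicIndex_eq {r : ℝ} (hr : 0 < r) (l : ℕ)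
    (x y : EuclideanSpace ℝ (Fin d)) (h : dyadicIndex r l x = dyadicIndex r l y) :
    ‖x - y‖ₑ ^ 2 ≤ (d : ℝ≥0∞) * ENNReal.ofReal r ^ 2 * 4⁻¹ ^ l := by
  have key : ‖x - y‖ ^ 2 ≤ d * r ^ 2 * (4⁻¹ : ℝ) ^ l := by
    rw [EuclideanSpace.norm_sq_eq]
    calc ∑ i, ‖(x - y) i‖ ^ 2 ≤ ∑ i : Fin d, r ^ 2 * (4⁻¹ : ℝ) ^ l := by
          refine Finset.sum_le_sum fun i _ => ?_
          have h1 := Int.abs_sub_lt_one_of_floor_eq_floor (congrFun h i)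
          rw [← sub_mul, ← sub_div, abs_mul, abs_div, abs_of_pos hr,
            abs_of_pos (by positivity : (0 : ℝ) < 2 ^ l)] at h1
          have h2 : ‖(x - y) i‖ ≤ r / 2 ^ l := by
            rw [le_div_iff₀ (by positivity), ← div_le_one hr, Real.norm_eq_abs, PiLp.sub_apply,
              mul_div_right_comm]
            exact h1.le
          calc ‖(x - y) i‖ ^ 2 ≤ (r / 2 ^ l) ^ 2 := by gcongr
            _ = _ := by
              rw [div_pow, ← pow_mul, mul_comm l, pow_mul, inv_pow, div_eq_mul_inv]
              norm_num
      _ = _ := by simp [mul_assoc]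
  rw [← ofReal_norm, ← ENNReal.ofReal_pow (norm_nonneg _)]
  refine (ENNReal.ofReal_le_ofReal key).trans_eq ?_
  rw [ENNReal.ofReal_mul (by positivity), ENNReal.ofReal_mul (by positivity),
    ENNReal.ofReal_pow hr.le, ENNReal.ofReal_pow (by positivity),
    ENNReal.ofReal_inv_of_pos (by norm_num)]
  simp

theorem dyadicIndex_mem {r : ℝ} (hr : 0 < r) (l : ℕ) {x : EuclideanSpace ℝ (Fin d)}
    (hx : ‖x‖ ≤ r) :
    dyadicIndex r l x ∈ Fintype.piFinset fun _ : Fin d => Finset.Icc (-2 ^ l : ℤ) (2 ^ l) := by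
  rw [Fintype.mem_piFinset]
  intro i
  have h1 : |x i / r| ≤ 1 := by
    rw [abs_div, abs_of_pos hr, div_le_one hr]
    exact (PiLp.norm_apply_le x i).trans hx
  obtain ⟨h2, h3⟩ := abs_le.1 h1
  have h4 : (0 : ℝ) < 2 ^ l := by positivity
  rw [Finset.mem_Icc]
  constructor
  · rw [dyadicIndex, Int.le_floor]
    push_cast
    nlinarith
  · rw [dyadicIndex]
    refine Int.floor_le_iff.2 ?_
    push_cast
    nlinarith

theorem card_dyadicIndex_range_le (d l : ℕ) :
    (Fintype.piFinset fun _ : Fin d => Finset.Icc (-2 ^ l : ℤ) (2 ^ l)).card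
      ≤ 3 ^ d * (2 ^ d) ^ l := by
  rw [Fintype.card_piFinset]
  simp only [Int.card_Icc, Finset.prod_const, Finset.card_univ, Fintype.card_fin]
  rw [← pow_mul, mul_comm d l, pow_mul, ← mul_pow]
  refine Nat.pow_le_pow_left ?_ _
  have : (1 : ℤ) ≤ 2 ^ l := one_le_pow₀ (by norm_num)
  zify
  rw [Int.toNat_of_nonneg (by linarith)]
  linarith

end DyadicCells

/-! ### Mean discrepancy of the empirical measure on a single set -/

section AbsDiff

theorem absDiff_eq_enorm {a b : ℝ≥0∞} (ha : a ≠ ∞) (hb : b ≠ ∞) :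
    absDiff a b = ‖b.toReal - a.toReal‖ₑ := by
  rcases le_total a b with h | h
  · rw [absDiff, tsub_eq_zero_of_le h, zero_add, ← ENNReal.toReal_sub_of_le h hb,
      Real.enorm_of_nonneg ENNReal.toReal_nonneg, ENNReal.ofReal_toReal]
    exact ENNReal.sub_ne_top hb
  · rw [absDiff, tsub_eq_zero_of_le h, add_zero, enorm_sub_rev, ← ENNReal.toReal_sub_of_le h ha,
      Real.enorm_of_nonneg ENNReal.toReal_nonneg, ENNReal.ofReal_toReal]
    exact ENNReal.sub_ne_top ha

theorem absDiff_le_add (a b : ℝ≥0∞) : absDiff a b ≤ a + b :=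
  add_le_add tsub_le_self tsub_le_self

end AbsDiff

section Empirical

variable {E : Type*} [MeasurableSpace E] {Ω : Type*} [MeasurableSpace Ω] {P : Measure Ω}
  {μ : Measure E} {N : ℕ} {X : Fin N → Ω → E}

theorem isProbabilityMeasure_empiricalMeas (hN : 0 < N) (x : Fin N → E) :
    IsProbabilityMeasure (empiricalMeas x) := by
  constructor
  simp only [empiricalMeas, Measure.smul_apply, Measure.finsetSum_apply, measure_univ,
    Finset.sum_const, Finset.card_univ, Fintype.card_fin, smul_eq_mul, nsmul_eq_mul, mul_one]
  exact ENNReal.inv_mul_cancel (by simpa using hN.ne') (by simp)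

theorem empiricalMeas_apply (x : Fin N → E) {F : Set E} (hF : MeasurableSet F) :
    empiricalMeas x F = (N : ℝ≥0∞)⁻¹ * ∑ i, F.indicator 1 (x i) := by
  simp [empiricalMeas, Measure.finsetSum_apply, Measure.dirac_apply' _ hF]

theorem aemeasurable_empiricalMeas (hX : ∀ i, AEMeasurable (X i) P) {F : Set E}
    (hF : MeasurableSet F) : AEMeasurable (fun ω => empiricalMeas (fun i => X i ω) F) P := by
  simp only [empiricalMeas_apply _ hF]
  refine AEMeasurable.const_mul ?_ _
  refine Finset.aemeasurable_fun_sum _ fun i _ => ?_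
  exact (measurable_one.indicator hF).comp_aemeasurable (hX i)

theorem lintegral_empiricalMeas (hN : 0 < N) (hX : ∀ i, HasLaw (X i) μ P) {F : Set E}
    (hF : MeasurableSet F) : ∫⁻ ω, empiricalMeas (fun i => X i ω) F ∂P = μ F := by
  simp only [empiricalMeas_apply _ hF]
  have hm : ∀ i, AEMeasurable (fun ω => F.indicator (1 : E → ℝ≥0∞) (X i ω)) P := fun i =>
    (measurable_one.indicator hF).comp_aemeasurable (hX i).aemeasurable
  rw [lintegral_const_mul'' _ (Finset.aemeasurable_fun_sum _ fun i _ => hm i),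
    lintegral_finsetSum' _ fun i _ => hm i]
  have : ∀ i, ∫⁻ ω, F.indicator (1 : E → ℝ≥0∞) (X i ω) ∂P = μ F := fun i => by
    rw [(hX i).lintegral_comp (f := F.indicator 1) (measurable_one.indicator hF).aemeasurable,
      lintegral_indicator_one hF]
  simp only [this, Finset.sum_const, Finset.card_univ, Fintype.card_fin, nsmul_eq_mul]
  rw [← mul_assoc, ENNReal.inv_mul_cancel (by simpa using hN.ne') (by simp), one_mul]

theorem aemeasurable_absDiff_empiricalMeas (hX : ∀ i, AEMeasurable (X i) P) {F : Set E}
    (hF : MeasurableSet F) :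
    AEMeasurable (fun ω => absDiff (μ F) (empiricalMeas (fun i => X i ω) F)) P := by
  have := aemeasurable_empiricalMeas hX hF
  exact (aemeasurable_const.sub this).add (this.sub aemeasurable_const)

variable [IsProbabilityMeasure P]

/-- The empirical mass of `F` is an average of `N` independent indicators, each of variance at most
its second moment `μ F`. -/
theorem variance_empiricalMeas_le (hN : 0 < N) (hind : iIndepFun X P)
    (hX : ∀ i, HasLaw (X i) μ P) {F : Set E} (hF : MeasurableSet F) :
    variance (fun ω => (empiricalMeas (fun i => X i ω) F).toReal) P ≤ μ.real F / N := by
  set Z : Fin N → Ω → ℝ := fun i ω => F.indicator 1 (X i ω) with hZ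
  have hfun : (fun ω => (empiricalMeas (fun i => X i ω) F).toReal)
      = fun ω => (N : ℝ)⁻¹ * (∑ i, Z i) ω := by
    ext ω
    rw [empiricalMeas_apply _ hF, ENNReal.toReal_mul, ENNReal.toReal_sum, Finset.sum_apply]
    · simp only [hZ, ENNReal.toReal_inv, ENNReal.toReal_natCast]
      congr 2 with i
      by_cases h : X i ω ∈ F <;> simp [h]
    · intro i _
      by_cases h : X i ω ∈ F <;> simp [h]
  have hmeas : Measurable (F.indicator (1 : E → ℝ)) := measurable_one.indicator hF
  have hZm : ∀ i, AEStronglyMeasurable (Z i) P := fun i =>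
    (hmeas.comp_aemeasurable (hX i).aemeasurable).aestronglyMeasurable
  have hZ2 : ∀ i, MemLp (Z i) 2 P := fun i => by
    refine MemLp.of_bound (hZm i) 1 (Filter.Eventually.of_forall fun ω => ?_)
    by_cases h : X i ω ∈ F <;> simp [hZ, h]
  have hvar : ∀ i, variance (Z i) P ≤ μ.real F := fun i => by
    refine (variance_le_expectation_sq (hZm i)).trans_eq ?_
    have : (Z i ^ 2) = fun ω => F.indicator (1 : E → ℝ) (X i ω) := by
      ext ω
      by_cases h : X i ω ∈ F <;> simp [hZ, h]
    rw [this]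
    have := (hX i).integral_comp (f := F.indicator (1 : E → ℝ)) hmeas.aestronglyMeasurable
    rw [Function.comp_def] at this
    rw [this, integral_indicator_one hF]
  rw [hfun, variance_const_mul, IndepFun.variance_sum (fun i _ => hZ2 i)]
  · have hN' : (0 : ℝ) < N := by exact_mod_cast hN
    calc ((N : ℝ)⁻¹) ^ 2 * ∑ i, variance (Z i) P ≤ ((N : ℝ)⁻¹) ^ 2 * ∑ i : Fin N, μ.real F := by
          gcongr with i
          exact hvar i
      _ = μ.real F / N := by
          simp only [Finset.sum_const, Finset.card_univ, Fintype.card_fin, nsmul_eq_mul]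
          field_simp
  · intro i _ j _ hij
    exact (hind.indepFun hij).comp hmeas hmeas

theorem lintegral_absDiff_le_sqrt [IsFiniteMeasure μ] (hN : 0 < N) (hind : iIndepFun X P)
    (hX : ∀ i, HasLaw (X i) μ P) {F : Set E} (hF : MeasurableSet F) :
    ∫⁻ ω, absDiff (μ F) (empiricalMeas (fun i => X i ω) F) ∂P ≤ (μ F / N) ^ (1 / 2 : ℝ) := by
  have hprob := fun ω => isProbabilityMeasure_empiricalMeas hN (fun i => X i ω)
  set Y : Ω → ℝ := fun ω => (empiricalMeas (fun i => X i ω) F).toReal with hY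
  have hYm : AEMeasurable Y P :=
    (aemeasurable_empiricalMeas (fun i => (hX i).aemeasurable) hF).ennreal_toReal
  have hYint : P[Y] = (μ F).toReal := by
    rw [hY, integral_toReal (aemeasurable_empiricalMeas (fun i => (hX i).aemeasurable) hF)
      (Filter.Eventually.of_forall fun ω => measure_lt_top _ _), lintegral_empiricalMeas hN hX hF]
  have hY2 : MemLp Y 2 P := by
    refine MemLp.of_bound hYm.aestronglyMeasurable 1 (Filter.Eventually.of_forall fun ω => ?_)
    rw [Real.norm_of_nonneg ENNReal.toReal_nonneg]
    exact ENNReal.toReal_le_of_le_ofReal zero_le_one (by simpa using prob_le_one)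
  have h1 : ∀ ω, absDiff (μ F) (empiricalMeas (fun i => X i ω) F) = ‖Y ω - P[Y]‖ₑ := fun ω => by
    rw [absDiff_eq_enorm (measure_ne_top _ _) (measure_ne_top _ _), hYint]
  have h2 : eLpNorm (fun ω => Y ω - P[Y]) 1 P ≤ eLpNorm (fun ω => Y ω - P[Y]) 2 P :=
    eLpNorm_le_eLpNorm_of_exponent_le (by norm_num) (hYm.sub_const _).aestronglyMeasurable
  simp only [h1]
  rw [eLpNorm_one_eq_lintegral_enorm] at h2
  refine h2.trans ?_
  rw [eLpNorm_eq_lintegral_rpow_enorm_toReal (by simp) (by simp)]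
  simp only [ENNReal.toReal_ofNat, ENNReal.rpow_ofNat]
  change evariance Y P ^ (1 / 2 : ℝ) ≤ _
  gcongr
  rw [← hY2.ofReal_variance_eq]
  refine (ENNReal.ofReal_le_ofReal (variance_empiricalMeas_le hN hind hX hF)).trans_eq ?_
  rw [ENNReal.ofReal_div_of_pos (by exact_mod_cast hN), ofReal_measureReal, ENNReal.ofReal_natCast]

theorem lintegral_absDiff_le_two_mul (hN : 0 < N) (hX : ∀ i, HasLaw (X i) μ P) {F : Set E}
    (hF : MeasurableSet F) :
    ∫⁻ ω, absDiff (μ F) (empiricalMeas (fun i => X i ω) F) ∂P ≤ 2 * μ F := by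
  calc _ ≤ ∫⁻ ω, (μ F + empiricalMeas (fun i => X i ω) F) ∂P :=
        lintegral_mono fun ω => absDiff_le_add _ _
    _ = 2 * μ F := by
      rw [lintegral_add_left measurable_const, lintegral_empiricalMeas hN hX hF]
      simp [two_mul]

end Empirical

/-! ### Mean discrepancy summed over cells -/

section ExpectedDiscrepancy

theorem ENNReal.sum_rpow_half_le {ι : Type*} (s : Finset ι) (a : ι → ℝ≥0∞) :
    ∑ i ∈ s, a i ^ (1 / 2 : ℝ) ≤ (s.card * ∑ i ∈ s, a i) ^ (1 / 2 : ℝ) := by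
  have h := ENNReal.inner_le_Lp_mul_Lq s (fun _ => 1) (fun i => a i ^ (1 / 2 : ℝ))
    Real.HolderConjugate.two_two
  rw [ENNReal.mul_rpow_of_nonneg _ _ (by norm_num)]
  have h2 : ∀ i, (a i ^ (1 / 2 : ℝ)) ^ (2 : ℝ) = a i := fun i => by
    rw [← ENNReal.rpow_mul]
    norm_num
  simpa only [h2, one_mul, ENNReal.one_rpow, Finset.sum_const, nsmul_eq_mul, mul_one] using h

variable {E ι : Type*} [MeasurableSpace E] [Countable ι] [MeasurableSpace ι]
  [MeasurableSingletonClass ι]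

theorem tsum_measure_inter_fiber (μ : Measure E) {s : Set E} {g : E → ι} (hg : Measurable g) :
    ∑' i, μ (s ∩ g ⁻¹' {i}) = μ s := by
  have := measure_univ_eq_tsum_fiber (μ.restrict s) hg
  rw [Measure.restrict_apply_univ] at this
  rw [this]
  refine tsum_congr fun i => ?_
  rw [Measure.restrict_apply (hg (measurableSet_singleton i)), Set.inter_comm]

variable {Ω : Type*} [MeasurableSpace Ω] {P : Measure Ω}
  {μ : Measure E} {N : ℕ} {X : Fin N → Ω → E}

theorem aemeasurable_fiberDiff (hX : ∀ i, AEMeasurable (X i) P) {s : Set E}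
    (hs : MeasurableSet s) {g : E → ι} (hg : Measurable g) :
    AEMeasurable (fun ω => fiberDiff μ (empiricalMeas fun i => X i ω) s g) P :=
  AEMeasurable.tsum fun i => aemeasurable_absDiff_empiricalMeas hX
    (hs.inter (hg (measurableSet_singleton i)))

theorem aemeasurable_multiscaleDiff (hX : ∀ i, AEMeasurable (X i) P) {s : Set E}
    (hs : MeasurableSet s) {f : ℕ → E → ι} (hf : ∀ l, Measurable (f l)) (L : ℕ) :
    AEMeasurable (fun ω => multiscaleDiff μ (empiricalMeas fun i => X i ω) s f L) P :=
  aemeasurable_const.add (Finset.aemeasurable_fun_sum _ fun l _ =>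
    (aemeasurable_fiberDiff hX hs (hf l)).const_mul _)

variable [IsProbabilityMeasure P]

theorem lintegral_fiberDiff_le_two_mul (hN : 0 < N) (hX : ∀ i, HasLaw (X i) μ P) {s : Set E}
    (hs : MeasurableSet s) {g : E → ι} (hg : Measurable g) :
    ∫⁻ ω, fiberDiff μ (empiricalMeas fun i => X i ω) s g ∂P ≤ 2 * μ s := by
  have hm : ∀ i, MeasurableSet (s ∩ g ⁻¹' {i}) := fun i =>
    hs.inter (hg (measurableSet_singleton i))
  simp only [fiberDiff]
  rw [lintegral_tsum fun i =>
    aemeasurable_absDiff_empiricalMeas (fun i => (hX i).aemeasurable) (hm i)]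
  refine (ENNReal.tsum_le_tsum fun i => lintegral_absDiff_le_two_mul hN hX (hm i)).trans_eq ?_
  rw [ENNReal.tsum_mul_left, tsum_measure_inter_fiber μ hg]

/-- Cauchy-Schwarz over the at most `S.card` cells that meet `s` turns the sum of standard
deviations into a single square root. -/
theorem lintegral_fiberDiff_le_sqrt [IsFiniteMeasure μ] (hN : 0 < N) (hind : iIndepFun X P)
    (hX : ∀ i, HasLaw (X i) μ P) {s : Set E} (hs : MeasurableSet s) {g : E → ι}
    (hg : Measurable g) {S : Finset ι} (hS : ∀ x ∈ s, g x ∈ S) :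
    ∫⁻ ω, fiberDiff μ (empiricalMeas fun i => X i ω) s g ∂P
      ≤ (S.card * (μ s / N)) ^ (1 / 2 : ℝ) := by
  have hm : ∀ i, MeasurableSet (s ∩ g ⁻¹' {i}) := fun i =>
    hs.inter (hg (measurableSet_singleton i))
  have hempty : ∀ i ∉ S, s ∩ g ⁻¹' {i} = ∅ := by
    intro i hi
    ext x
    simp only [Set.mem_inter_iff, Set.mem_preimage, Set.mem_singleton_iff, Set.mem_empty_iff_false,
      iff_false, not_and]
    rintro hx rfl
    exact hi (hS x hx)
  simp only [fiberDiff]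
  rw [lintegral_tsum fun i =>
    aemeasurable_absDiff_empiricalMeas (fun i => (hX i).aemeasurable) (hm i)]
  calc _ ≤ ∑' i, (μ (s ∩ g ⁻¹' {i}) / N) ^ (1 / 2 : ℝ) :=
        ENNReal.tsum_le_tsum fun i => lintegral_absDiff_le_sqrt hN hind hX (hm i)
    _ = ∑ i ∈ S, (μ (s ∩ g ⁻¹' {i}) / N) ^ (1 / 2 : ℝ) :=
        tsum_eq_sum fun i hi => by simp [hempty i hi]
    _ ≤ (S.card * ∑ i ∈ S, μ (s ∩ g ⁻¹' {i}) / N) ^ (1 / 2 : ℝ) := ENNReal.sum_rpow_half_le _ _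
    _ ≤ _ := by
        gcongr
        calc _ ≤ ∑' i, μ (s ∩ g ⁻¹' {i}) / N := ENNReal.sum_le_tsum S
          _ = μ s / N := by
            simp only [div_eq_mul_inv]
            rw [ENNReal.tsum_mul_right, tsum_measure_inter_fiber μ hg]

end ExpectedDiscrepancy

/-! ### Choice of the number of scales -/

section Rates

theorem sum_range_pow_le_of_one_lt {ρ : ℝ} (hρ : 1 < ρ) (L : ℕ) :
    ∑ l ∈ Finset.range (L + 1), ρ ^ l ≤ ρ / (ρ - 1) * ρ ^ L := by
  have h : 0 < ρ - 1 := by linarith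
  rw [geom_sum_eq hρ.ne', div_mul_eq_mul_div]
  gcongr
  rw [pow_succ']
  linarith

/-- The optimal depth of the multiscale matching. -/
theorem exists_depth_bound {d : ℕ} (hd : 4 < d) :
    ∃ C : ℝ, 0 < C ∧ ∀ m N : ℝ, 0 < m → 0 < N → ∃ L : ℕ, ∀ e : ℕ → ℝ, (∀ l, e l ≤ 2 * m) →
      (∀ l, e l ≤ √(3 ^ d * (2 ^ d) ^ l * (m / N))) →
      (4⁻¹ : ℝ) ^ L * m + ∑ l ∈ Finset.range (L + 1), (4⁻¹ : ℝ) ^ l * e l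
        ≤ C * (m * (N * m) ^ (-(2 / d : ℝ))) := by
  have hd0 : (0 : ℝ) < d := by exact_mod_cast (by omega : 0 < d)
  set θ : ℝ := 2 / d with hθ
  have hθ0 : 0 < θ := by positivity
  -- `ρ` is the growth ratio of the summands `4^(-l) √(2^(dl))`; `d > 4` is exactly the condition `ρ
  -- > 1`.
  set ρ : ℝ := √(2 ^ d) / 4 with hρdef
  have hρ : 1 < ρ := by
    rw [hρdef, one_lt_div (by norm_num), Real.lt_sqrt (by norm_num)]
    calc (4 : ℝ) ^ 2 = 2 ^ 4 := by norm_num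
      _ < 2 ^ d := pow_lt_pow_right₀ (by norm_num) hd
  have hρ1 : 0 < ρ - 1 := by linarith
  have hy : ((2 : ℝ) ^ d) ^ θ = 4 := by
    rw [← Real.rpow_natCast, ← Real.rpow_mul (by norm_num), hθ, mul_div_cancel₀ _ hd0.ne']
    norm_num
  have hsp : ∀ l : ℕ, √(((2 : ℝ) ^ d) ^ l) = √(2 ^ d) ^ l := fun l => by
    rw [← Real.sqrt_sq (pow_nonneg (Real.sqrt_nonneg _) l), ← pow_mul √(2 ^ d), mul_comm l,
      pow_mul √(2 ^ d), Real.sq_sqrt (by positivity)]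
  refine ⟨4 + 4 * √(3 ^ d) * (ρ / (ρ - 1)), by positivity, fun m N hm hN => ?_⟩
  have ha : 0 < N * m := by positivity
  -- With at most one expected sample, one scale and the trivial bound `e 0 ≤ 2 * m` suffice.
  rcases le_or_gt (N * m) 1 with h1 | h1
  · refine ⟨0, fun e he _ => ?_⟩
    have h2 : 1 ≤ (N * m) ^ (-θ) := Real.one_le_rpow_of_pos_of_le_one_of_nonpos ha h1 (by linarith)
    have h3 : m ≤ m * (N * m) ^ (-θ) := le_mul_of_one_le_right hm.le h2
    have h4 : 0 ≤ 4 * √(3 ^ d) * (ρ / (ρ - 1)) * (m * (N * m) ^ (-θ)) := by positivity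
    have := he 0
    simp only [pow_zero, zero_add, Finset.sum_range_one, one_mul]
    rw [add_mul]
    linarith
  -- `L` is chosen with `2^(dL) ≤ N m < 2^(d(L+1))`, so that `4^(-L)` is comparable to `(N
  -- m)^(-2/d)`.
  · obtain ⟨L, hL1, hL2⟩ := exists_nat_pow_near h1.le
      (one_lt_pow₀ (by norm_num : (1 : ℝ) < 2) (by omega : d ≠ 0))
    refine ⟨L, fun e _ he => ?_⟩
    have hL3 : (N * m) ^ θ ≤ 4 ^ (L + 1) := by
      calc (N * m) ^ θ ≤ ((2 ^ d) ^ (L + 1)) ^ θ := by gcongr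
        _ = 4 ^ (L + 1) := by
          rw [← Real.rpow_natCast, ← Real.rpow_mul (by positivity), mul_comm _ θ,
            Real.rpow_mul (by positivity), hy, Real.rpow_natCast]
    have hL4 : (4⁻¹ : ℝ) ^ L ≤ 4 * (N * m) ^ (-θ) := by
      rw [Real.rpow_neg ha.le, inv_pow, ← div_eq_mul_inv, le_div_iff₀ (by positivity),
        inv_mul_le_iff₀ (by positivity)]
      rwa [pow_succ] at hL3
    have hterm : ∀ l, (4⁻¹ : ℝ) ^ l * e l ≤ √(3 ^ d) * √(m / N) * ρ ^ l := by
      intro l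
      calc (4⁻¹ : ℝ) ^ l * e l ≤ (4⁻¹ : ℝ) ^ l * √(3 ^ d * (2 ^ d) ^ l * (m / N)) := by
            gcongr
            exact he l
        _ = _ := by
            rw [Real.sqrt_mul (by positivity), Real.sqrt_mul (by positivity),
              hsp, hρdef, div_pow, inv_pow]
            ring
    have hρL : ρ ^ L ≤ √(N * m) * (4 * (N * m) ^ (-θ)) := by
      rw [hρdef, div_pow, ← hsp, div_eq_mul_inv, ← inv_pow]
      gcongr
    -- This identity gives the stochastic sum the same order as the truncation term `4^(-L) m`.
    have hsq : √(m / N) * √(N * m) = m := by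
      rw [← Real.sqrt_mul (by positivity), show m / N * (N * m) = m ^ 2 by field_simp,
        Real.sqrt_sq hm.le]
    calc _ ≤ 4 * (N * m) ^ (-θ) * m
          + ∑ l ∈ Finset.range (L + 1), √(3 ^ d) * √(m / N) * ρ ^ l := by
          refine add_le_add (by gcongr) (Finset.sum_le_sum fun l _ => hterm l)
      _ ≤ 4 * (N * m) ^ (-θ) * m
          + √(3 ^ d) * √(m / N) * (ρ / (ρ - 1) * (√(N * m) * (4 * (N * m) ^ (-θ)))) := by
          rw [← Finset.mul_sum]
          gcongr
          refine (sum_range_pow_le_of_one_lt hρ L).trans ?_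
          gcongr
      _ = 4 * (N * m) ^ (-θ) * m + √(3 ^ d) * (√(m / N) * √(N * m)) *
          (ρ / (ρ - 1) * (4 * (N * m) ^ (-θ))) := by ring
      _ = _ := by
          rw [hsq]
          ring

end Rates

/-! ### Expected multiscale discrepancy on a bounded set -/

section EmpiricalRate

theorem exists_expected_multiscaleDiff_le {d : ℕ} (hd : 4 < d) :
    ∃ C : ℝ, 0 < C ∧ ∀ {Ω : Type*} [MeasurableSpace Ω] (P : Measure Ω) [IsProbabilityMeasure P]
      (μ : Measure (EuclideanSpace ℝ (Fin d))) [IsProbabilityMeasure μ] (N : ℕ)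
      (X : Fin N → Ω → EuclideanSpace ℝ (Fin d)), 0 < N → iIndepFun X P →
      (∀ i, HasLaw (X i) μ P) → ∀ (r : ℝ) (s : Set (EuclideanSpace ℝ (Fin d))), 0 < r →
      MeasurableSet s → (∀ x ∈ s, ‖x‖ ≤ r) → ∃ L : ℕ,
      ∫⁻ ω, multiscaleDiff μ (empiricalMeas fun i => X i ω) s (dyadicIndex r) L ∂P
        ≤ ENNReal.ofReal (C * (μ.real s * (N * μ.real s) ^ (-(2 / d : ℝ)))) := by
  obtain ⟨C, hC, h⟩ := exists_depth_bound hd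
  refine ⟨C, hC, fun P _ μ _ N X hN hind hX r s hr hs hsr => ?_⟩
  have hXm := fun i => (hX i).aemeasurable
  set e : ℕ → ℝ≥0∞ := fun l =>
    ∫⁻ ω, fiberDiff μ (empiricalMeas fun i => X i ω) s (dyadicIndex r l) ∂P with he
  have he2 : ∀ l, e l ≤ 2 * μ s := fun l =>
    lintegral_fiberDiff_le_two_mul hN hX hs (measurable_dyadicIndex r l)
  have hexp : ∀ L, ∫⁻ ω, multiscaleDiff μ (empiricalMeas fun i => X i ω) s (dyadicIndex r) L ∂P
      = 4⁻¹ ^ L * μ s + ∑ l ∈ Finset.range (L + 1), 4⁻¹ ^ l * e l := by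
    intro L
    have hm : ∀ l, AEMeasurable
        (fun ω => fiberDiff μ (empiricalMeas fun i => X i ω) s (dyadicIndex r l)) P :=
      fun l => aemeasurable_fiberDiff hXm hs (measurable_dyadicIndex r l)
    simp only [multiscaleDiff]
    rw [lintegral_add_left measurable_const, lintegral_finsetSum' _ fun l _ => (hm l).const_mul _]
    simp only [lintegral_const, measure_univ, mul_one]
    congr 1
    exact Finset.sum_congr rfl fun l _ => lintegral_const_mul'' _ (hm l)
  -- The depth bound needs positive mass; on a null set every mean discrepancy vanishes.
  rcases eq_or_ne (μ s) 0 with h0 | h0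
  · refine ⟨0, ?_⟩
    rw [hexp, h0]
    have h00 : e 0 = 0 := by simpa [h0] using he2 0
    simp [h00]
  have hm : 0 < μ.real s := ENNReal.toReal_pos h0 (measure_ne_top _ _)
  have hN' : (0 : ℝ) < N := by exact_mod_cast hN
  have hfin : ∀ l, e l ≠ ∞ := fun l =>
    ((he2 l).trans_lt (ENNReal.mul_lt_top (by simp) (measure_lt_top _ _))).ne
  obtain ⟨L, hL⟩ := h (μ.real s) N hm hN'
  refine ⟨L, ?_⟩
  rw [hexp, ← ENNReal.ofReal_toReal (a := _ + _)]
  · refine ENNReal.ofReal_le_ofReal (le_trans (le_of_eq ?_) (hL (fun l => (e l).toReal) ?_ ?_))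
    · rw [ENNReal.toReal_add, ENNReal.toReal_sum]
      · simp [measureReal_def]
      · exact fun l _ => ENNReal.mul_ne_top (by simp) (hfin l)
      · exact ENNReal.mul_ne_top (by simp) (measure_ne_top _ _)
      · exact ENNReal.sum_ne_top.2 fun l _ => ENNReal.mul_ne_top (by simp) (hfin l)
    · intro l
      have := ENNReal.toReal_mono (ENNReal.mul_ne_top (by simp) (measure_ne_top _ _)) (he2 l)
      simpa [measureReal_def] using this
    · intro l
      have h1 : e l ≤ _ := lintegral_fiberDiff_le_sqrt hN hind hX hs (measurable_dyadicIndex r l)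
        fun x hx => dyadicIndex_mem hr l (hsr x hx)
      have h2 : e l ≤ (ENNReal.ofReal (3 ^ d * (2 ^ d) ^ l * (μ.real s / N))) ^ (1 / 2 : ℝ) := by
        refine h1.trans ?_
        gcongr
        rw [ENNReal.ofReal_mul (by positivity), ENNReal.ofReal_div_of_pos hN', ofReal_measureReal,
          ENNReal.ofReal_natCast]
        gcongr
        have := card_dyadicIndex_range_le d l
        rw [show (3 ^ d * (2 ^ d) ^ l : ℝ) = ((3 ^ d * (2 ^ d) ^ l : ℕ) : ℝ) by push_cast; rfl,
          ENNReal.ofReal_natCast]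
        exact_mod_cast this
      rw [ENNReal.ofReal_rpow_of_nonneg (by positivity) (by norm_num), ← Real.sqrt_eq_rpow] at h2
      exact ENNReal.toReal_le_of_le_ofReal (Real.sqrt_nonneg _) h2
  · exact ENNReal.add_ne_top.2 ⟨ENNReal.mul_ne_top (by simp) (measure_ne_top _ _),
      ENNReal.sum_ne_top.2 fun l _ => ENNReal.mul_ne_top (by simp) (hfin l)⟩

/-! ### Dyadic annuli and tail bounds from the `q`-th moment -/

section Moments

theorem lintegral_empiricalMeas_eq {E : Type*} [MeasurableSpace E] {N : ℕ} (x : Fin N → E) {g : E → ℝ≥0∞} (hg : Measurable g) :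
    ∫⁻ u, g u ∂(empiricalMeas x) = (N : ℝ≥0∞)⁻¹ * ∑ i, g (x i) := by
  rw [empiricalMeas, lintegral_smul_measure, lintegral_finsetSum_measure]
  simp [lintegral_dirac' _ hg]

variable {E : Type*} [NormedAddCommGroup E]

/-- Dyadic annuli `{x | R 2 ^ (n - 1) < ‖x‖ ≤ R 2 ^ n}`, with the ball of radius `R` for `n = 0`. -/
def dyadicAnnulus (E : Type*) [NormedAddCommGroup E] (R : ℝ) (n : ℕ) : Set E :=
  disjointed (fun n => Metric.closedBall (0 : E) (R * 2 ^ n)) n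

theorem norm_le_of_mem_dyadicAnnulus {R : ℝ} {n : ℕ} {x : E} (hx : x ∈ dyadicAnnulus E R n) :
    ‖x‖ ≤ R * 2 ^ n := by
  simpa using disjointed_subset _ n hx

theorem iUnion_dyadicAnnulus {R : ℝ} (hR : 0 < R) : ⋃ n, dyadicAnnulus E R n = Set.univ := by
  simp only [dyadicAnnulus]
  rw [iUnion_disjointed, Set.eq_univ_iff_forall]
  intro x
  obtain ⟨n, hn⟩ := pow_unbounded_of_one_lt (‖x‖ / R) one_lt_two
  refine Set.mem_iUnion.2 ⟨n, ?_⟩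
  rw [div_lt_iff₀' hR] at hn
  simpa using hn.le

variable [MeasurableSpace E] [BorelSpace E]

theorem momentNorm_empiricalMeas_lt_top {N : ℕ} (hN : 0 < N) (x : Fin N → E) :
    momentNorm 2 (empiricalMeas x) < ∞ := by
  rw [momentNorm, lintegral_empiricalMeas_eq x (by fun_prop)]
  refine ENNReal.rpow_lt_top_of_nonneg (by norm_num) (ENNReal.mul_ne_top ?_ ?_)
  · simpa using hN.ne'
  · exact ENNReal.sum_ne_top.2 fun i _ => by simp

theorem measurableSet_dyadicAnnulus (R : ℝ) (n : ℕ) : MeasurableSet (dyadicAnnulus E R n) :=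
  MeasurableSet.disjointed (fun _ => Metric.isClosed_closedBall.measurableSet) n

/-- Markov's inequality for `‖x‖ ^ q`: annulus `n + 1` lies outside radius `R 2^n`, and this
off-by-one is the prefactor `2 ^ q`. For `n = 0` that prefactor already exceeds a probability. -/
theorem measureReal_dyadicAnnulus_le {q : ℝ} (hq : 0 < q) (μ : Measure E) [IsProbabilityMeasure μ]
    (hμ : momentNorm q μ < ∞) (hR : 0 < (momentNorm q μ).toReal) (n : ℕ) :
    μ.real (dyadicAnnulus E (momentNorm q μ).toReal n) ≤ 2 ^ q * ((2 ^ q)⁻¹) ^ n := by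
  set R := (momentNorm q μ).toReal with hRdef
  cases n with
  | zero =>
    rw [pow_zero, mul_one]
    exact measureReal_le_one.trans (Real.one_le_rpow (by norm_num) hq.le)
  | succ n =>
    have hsub : dyadicAnnulus E R (n + 1) ⊆ {x | ENNReal.ofReal (R * 2 ^ n) ^ q ≤ ‖x‖ₑ ^ q} := by
      intro x hx
      have hmono : Monotone fun n => Metric.closedBall (0 : E) (R * 2 ^ n) := fun a b hab =>
        Metric.closedBall_subset_closedBall (by gcongr; norm_num)
      rw [dyadicAnnulus, hmono.disjointed_add_one] at hx
      have h2 : R * 2 ^ n ≤ ‖x‖ := by simpa using (not_le.1 (by simpa using hx.2)).le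
      change _ ≤ ‖x‖ₑ ^ q
      rw [← ofReal_norm]
      gcongr
    have hM : ∫⁻ u, ‖u‖ₑ ^ q ∂μ = ENNReal.ofReal R ^ q := by
      rw [hRdef, ENNReal.ofReal_toReal hμ.ne, momentNorm, ← ENNReal.rpow_mul, one_div,
        inv_mul_cancel₀ hq.ne', ENNReal.rpow_one]
    have hmark : ENNReal.ofReal (R * 2 ^ n) ^ q * μ (dyadicAnnulus E R (n + 1))
        ≤ ENNReal.ofReal R ^ q := by
      rw [← hM]
      refine le_trans ?_ (mul_meas_ge_le_lintegral (by fun_prop)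
        (ENNReal.ofReal (R * 2 ^ n) ^ q))
      gcongr
    have hreal : (R * 2 ^ n) ^ q * μ.real (dyadicAnnulus E R (n + 1)) ≤ R ^ q := by
      have := ENNReal.toReal_mono (by simp [hq.le]) hmark
      rwa [ENNReal.toReal_mul, ← ENNReal.toReal_rpow, ← ENNReal.toReal_rpow,
        ENNReal.toReal_ofReal hR.le, ENNReal.toReal_ofReal (by positivity)] at this
    rw [Real.mul_rpow hR.le (by positivity), mul_assoc] at hreal
    have h3 : ((2 : ℝ) ^ n) ^ q * μ.real (dyadicAnnulus E R (n + 1)) ≤ 1 :=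
      le_of_mul_le_mul_left (by rwa [mul_one]) (Real.rpow_pos_of_pos hR q)
    rw [← Real.rpow_natCast, ← Real.rpow_mul (by norm_num), mul_comm (n : ℝ) q,
      Real.rpow_mul (by norm_num), Real.rpow_natCast] at h3
    have h4 : (0 : ℝ) < 2 ^ q := by positivity
    rw [pow_succ', ← mul_assoc, mul_inv_cancel₀ h4.ne', one_mul, inv_pow,
      ← one_div, le_div_iff₀' (by positivity)]
    exact h3

end Moments

end EmpiricalRate

/-! ### Empirical convergence in mean and in probability -/

section EmpiricalRate

theorem wasserstein_two_sq_le {E : Type*} [NormedAddCommGroup E] [MeasurableSpace E]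
    {γ γ' : Measure E} (hγ : momentNorm 2 γ < ∞) (hγ' : momentNorm 2 γ' < ∞)
    {π : Measure (E × E)} (hπ : π ∈ couplings γ γ') :
    wasserstein 2 γ γ' ^ 2 ≤ ∫⁻ z, ‖z.1 - z.2‖ₑ ^ 2 ∂π := by
  calc wasserstein 2 γ γ' ^ 2 ≤ ((∫⁻ z, ‖z.1 - z.2‖ₑ ^ (2 : ℝ) ∂π) ^ (1 / 2 : ℝ)) ^ 2 := by
        gcongr
        exact wasserstein_le_of_coupling two_pos hγ hγ' hπ
    _ = _ := by
        rw [← ENNReal.rpow_natCast, ← ENNReal.rpow_mul]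
        norm_num

/-- A Fournier-Guillin bound: the squared Wasserstein distance of a measure and its empirical
measure has a measurable majorant with expectation of order `χ_q(μ) ^ 2 * N ^ (-2 / d)`. -/
theorem exists_wasserstein_majorant {d : ℕ} (hd : 4 < d) {q : ℝ}
    (hq : 2 * (d : ℝ) / ((d : ℝ) - 2) < q) :
    ∃ C : ℝ, 0 < C ∧ ∀ {Ω : Type*} [MeasurableSpace Ω] (P : Measure Ω) [IsProbabilityMeasure P]
      (μ : Measure (EuclideanSpace ℝ (Fin d))) [IsProbabilityMeasure μ] (N : ℕ)
      (X : Fin N → Ω → EuclideanSpace ℝ (Fin d)), 0 < N → iIndepFun X P →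
      (∀ i, HasLaw (X i) μ P) → momentNorm 2 μ < ∞ → momentNorm q μ < ∞ →
      ∃ U : Ω → ℝ≥0∞, AEMeasurable U P ∧
        ∫⁻ ω, U ω ∂P
          ≤ ENNReal.ofReal (C * ((momentNorm q μ).toReal ^ 2 * (N : ℝ) ^ (-(2 / d : ℝ)))) ∧
        ∀ ω, wasserstein 2 μ (empiricalMeas fun i => X i ω) ^ 2 ≤ U ω := by
  obtain ⟨C, hC, h⟩ := exists_expected_multiscaleDiff_le hd
  have hd4 : (4 : ℝ) < d := by exact_mod_cast hd
  have hd0 : (0 : ℝ) < d := by linarith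
  have hq0 : 0 < q := lt_trans (div_pos (by linarith) (by linarith)) hq
  set θ : ℝ := 2 / d with hθ
  have hθ1 : θ < 1 := by rw [hθ, div_lt_one hd0]; linarith
  -- The contribution of annulus `n` is at most of order `4^n m_n^(1 - θ)`, hence of order `(4 /
  -- a)^n`; `a > 4` is a rewriting of `q > 2d/(d-2)`.
  set a : ℝ := (2 ^ q) ^ (1 - θ) with ha
  have ha4 : 4 < a := by
    have h1 : 2 < q * (1 - θ) := by
      rw [div_lt_iff₀ (by linarith)] at hq
      have : q * (1 - θ) = q * (d - 2) / d := by rw [hθ]; field_simp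
      rwa [this, lt_div_iff₀ hd0]
    calc (4 : ℝ) = 2 ^ (2 : ℝ) := by norm_num
      _ < 2 ^ (q * (1 - θ)) := Real.rpow_lt_rpow_of_exponent_lt (by norm_num) h1
      _ = a := by rw [ha, ← Real.rpow_mul (by norm_num)]
  have ha0 : 0 < a := by linarith
  have hτ0 : 0 ≤ 4 * a⁻¹ := by positivity
  have hτ1 : 4 * a⁻¹ < 1 := by rwa [← div_eq_mul_inv, div_lt_one ha0]
  refine ⟨4 * d * (C * a * (1 - 4 * a⁻¹)⁻¹), ?_, ?_⟩
  · have : 0 < (1 - 4 * a⁻¹)⁻¹ := inv_pos.2 (by linarith)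
    positivity
  intro Ω _ P _ μ _ N X hN hind hX hμ2 hμq
  have hXm := fun i => (hX i).aemeasurable
  have hprob := fun ω => isProbabilityMeasure_empiricalMeas hN (fun i => X i ω)
  have hN' : (0 : ℝ) < N := by exact_mod_cast hN
  set R := (momentNorm q μ).toReal with hRdef
  rcases (ENNReal.toReal_nonneg : 0 ≤ (momentNorm q μ).toReal).eq_or_lt with hR | hR
  -- If `R = 0` the annuli degenerate, but `μ` is then concentrated at the origin and so, almost
  -- surely, are the samples. The product coupling gives a majorant that vanishes almost surely.
  · have hμ0 : ∀ᵐ x ∂μ, ‖x‖ₑ ^ 2 = 0 := by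
      have h1 : momentNorm q μ = 0 := by
        rcases (ENNReal.toReal_eq_zero_iff _).1 hR.symm with h1 | h1
        · exact h1
        · exact absurd h1 hμq.ne
      rw [momentNorm, ENNReal.rpow_eq_zero_iff_of_pos (by positivity),
        lintegral_eq_zero_iff (by fun_prop)] at h1
      filter_upwards [h1] with x hx
      have : ‖x‖ₑ = 0 := (ENNReal.rpow_eq_zero_iff_of_pos hq0).1 hx
      simp [this]
    refine ⟨fun ω => ∫⁻ u, 2 * ‖u‖ₑ ^ 2 ∂(empiricalMeas fun i => X i ω), ?_, ?_, fun ω => ?_⟩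
    · simp only [lintegral_empiricalMeas_eq _ (by fun_prop :
        Measurable fun u : EuclideanSpace ℝ (Fin d) => 2 * ‖u‖ₑ ^ 2)]
      fun_prop
    · have hae : ∀ᵐ ω ∂P, ∀ i, ‖X i ω‖ₑ ^ 2 = 0 := ae_all_iff.2 fun i =>
        ((hX i).ae_iff (p := fun x => ‖x‖ₑ ^ 2 = 0)
          (measurableSet_setOfPred.1 (measurableSet_eq_fun
            (f := fun x : EuclideanSpace ℝ (Fin d) => ‖x‖ₑ ^ 2) (by fun_prop)
            measurable_const))).2 hμ0
      have : ∫⁻ ω, ∫⁻ u, 2 * ‖u‖ₑ ^ 2 ∂(empiricalMeas fun i => X i ω) ∂P = 0 := by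
        rw [← lintegral_zero (μ := P)]
        refine lintegral_congr_ae ?_
        filter_upwards [hae] with ω hω
        rw [lintegral_empiricalMeas_eq _ (by fun_prop)]
        simp [hω]
      rw [this]
      exact bot_le
    · have hπ : μ.prod (empiricalMeas fun i => X i ω) ∈ couplings μ (empiricalMeas fun i => X i ω) :=
        ⟨inferInstance, Measure.fst_prod, Measure.snd_prod⟩
      refine (wasserstein_two_sq_le hμ2 (momentNorm_empiricalMeas_lt_top hN _) hπ).trans ?_
      calc _ ≤ ∫⁻ z, (2 * ‖z.1‖ₑ ^ 2 + 2 * ‖z.2‖ₑ ^ 2)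
            ∂(μ.prod (empiricalMeas fun i => X i ω)) :=
            lintegral_mono fun z => enorm_sub_sq_le _ _
        _ = ∫⁻ u, 2 * ‖u‖ₑ ^ 2 ∂(μ.prod (empiricalMeas fun i => X i ω)).fst +
            ∫⁻ u, 2 * ‖u‖ₑ ^ 2 ∂(μ.prod (empiricalMeas fun i => X i ω)).snd := by
            rw [Measure.fst, Measure.snd, lintegral_map (by fun_prop) (by fun_prop),
              lintegral_map (by fun_prop) (by fun_prop), lintegral_add_left (by fun_prop)]
        _ = _ := by
            rw [Measure.fst_prod, Measure.snd_prod]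
            have : ∫⁻ u, 2 * ‖u‖ₑ ^ 2 ∂μ = 0 := by
              rw [lintegral_eq_zero_iff (by fun_prop)]
              filter_upwards [hμ0] with x hx
              simp [hx]
            rw [this, zero_add]
  · set r : ℕ → ℝ := fun n => R * 2 ^ n with hr
    have hr0 : ∀ n, 0 < r n := fun n => by positivity
    set s := dyadicAnnulus (EuclideanSpace ℝ (Fin d)) R with hs
    choose L hL using fun n => h P μ N X hN hind hX (r n) (s n) (hr0 n)
      (measurableSet_dyadicAnnulus R n) (fun x hx => norm_le_of_mem_dyadicAnnulus hx)
    have hm : ∀ n, AEMeasurable (fun ω => ENNReal.ofReal (r n) ^ 2 *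
        multiscaleDiff μ (empiricalMeas fun i => X i ω) (s n) (dyadicIndex (r n)) (L n)) P :=
      fun n => (aemeasurable_multiscaleDiff hXm (measurableSet_dyadicAnnulus R n)
        (measurable_dyadicIndex (r n)) (L n)).const_mul _
    refine ⟨fun ω => 4 * d * ∑' n, ENNReal.ofReal (r n) ^ 2 *
      multiscaleDiff μ (empiricalMeas fun i => X i ω) (s n) (dyadicIndex (r n)) (L n),
      (AEMeasurable.tsum hm).const_mul _, ?_, fun ω => ?_⟩
    · rw [lintegral_const_mul'' _ (AEMeasurable.tsum hm), lintegral_tsum hm]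
      have hterm : ∀ n, r n ^ 2 * (C * (μ.real (s n) * (N * μ.real (s n)) ^ (-θ)))
          ≤ C * (R ^ 2 * (N : ℝ) ^ (-θ)) * a * (4 * a⁻¹) ^ n := by
        intro n
        have hmn : μ.real (s n) * (N * μ.real (s n)) ^ (-θ)
            ≤ (N : ℝ) ^ (-θ) * (a * a⁻¹ ^ n) := by
          rcases (measureReal_nonneg : 0 ≤ μ.real (s n)).eq_or_lt with h0 | h0
          · rw [← h0, zero_mul]
            positivity
          · calc _ = (N : ℝ) ^ (-θ) * μ.real (s n) ^ (1 - θ) := by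
                  rw [Real.mul_rpow hN'.le h0.le, sub_eq_add_neg, Real.rpow_add h0, Real.rpow_one]
                  ring
              _ ≤ (N : ℝ) ^ (-θ) * (2 ^ q * ((2 ^ q)⁻¹) ^ n) ^ (1 - θ) := by
                  have := measureReal_dyadicAnnulus_le hq0 μ hμq hR n
                  have h1 : 0 ≤ 1 - θ := by linarith
                  gcongr
              _ = _ := by
                  rw [Real.mul_rpow (by positivity) (by positivity),
                    ← Real.rpow_pow_comm (by positivity), Real.inv_rpow (by positivity)]
        calc _ ≤ r n ^ 2 * (C * ((N : ℝ) ^ (-θ) * (a * a⁻¹ ^ n))) := by gcongr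
          _ = _ := by
            rw [hr, mul_pow, mul_pow, ← pow_mul, mul_comm n, pow_mul]
            norm_num
            ring
      have hsumm : Summable fun n => C * (R ^ 2 * (N : ℝ) ^ (-θ)) * a * (4 * a⁻¹) ^ n :=
        (summable_geometric_of_lt_one hτ0 hτ1).mul_left _
      calc _ ≤ 4 * d * ∑' n, ENNReal.ofReal (C * (R ^ 2 * (N : ℝ) ^ (-θ)) * a * (4 * a⁻¹) ^ n) := by
            gcongr with n
            rw [lintegral_const_mul' _ _ (by simp)]
            calc _ ≤ ENNReal.ofReal (r n) ^ 2 *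
                ENNReal.ofReal (C * (μ.real (s n) * (N * μ.real (s n)) ^ (-θ))) := by
                  gcongr
                  exact hL n
              _ = ENNReal.ofReal (r n ^ 2 * (C * (μ.real (s n) * (N * μ.real (s n)) ^ (-θ)))) := by
                  rw [ENNReal.ofReal_mul (p := r n ^ 2) (by positivity),
                    ENNReal.ofReal_pow (hr0 n).le]
              _ ≤ _ := ENNReal.ofReal_le_ofReal (hterm n)
        _ = 4 * d * ENNReal.ofReal (C * (R ^ 2 * (N : ℝ) ^ (-θ)) * a * (1 - 4 * a⁻¹)⁻¹) := by
            rw [← ENNReal.ofReal_tsum_of_nonneg (fun n => by positivity) hsumm, tsum_mul_left,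
              tsum_geometric_of_lt_one hτ0 hτ1]
        _ = _ := by
            rw [show (4 * d : ℝ≥0∞) = ENNReal.ofReal (4 * d) by
              rw [ENNReal.ofReal_mul (by norm_num), ENNReal.ofReal_natCast]; simp,
              ← ENNReal.ofReal_mul (by positivity)]
            congr 1
            ring
    · obtain ⟨π, hπ, hle⟩ := exists_coupling_annular (f := fun n => dyadicIndex (r n))
        (r := fun n => ENNReal.ofReal (r n)) (K := d) (s := s)
        (fun n l => measurable_dyadicIndex (r n) l) (fun n l => dyadicIndex_coarsen (r n) l)
        (fun n l => enorm_sub_sq_le_of_dyadicIndex_eq (hr0 n) l)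
        (by exact_mod_cast (by omega : 1 ≤ d)) (measurableSet_dyadicAnnulus R)
        (disjoint_disjointed _) (iUnion_dyadicAnnulus hR)
        (fun n x hx => by
          rw [← ofReal_norm]
          exact ENNReal.ofReal_le_ofReal (norm_le_of_mem_dyadicAnnulus hx))
        L μ (empiricalMeas fun i => X i ω)
      exact (wasserstein_two_sq_le hμ2 (momentNorm_empiricalMeas_lt_top hN _) hπ).trans hle

theorem exists_event_wasserstein_le {d : ℕ} (hd : 4 < d) {q : ℝ}
    (hq : 2 * (d : ℝ) / ((d : ℝ) - 2) < q) :
    ∃ C : ℝ, 0 < C ∧ ∀ {Ω : Type*} [MeasurableSpace Ω] (P : Measure Ω) [IsProbabilityMeasure P]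
      (μ : Measure (EuclideanSpace ℝ (Fin d))) [IsProbabilityMeasure μ] (N : ℕ)
      (X : Fin N → Ω → EuclideanSpace ℝ (Fin d)), 0 < N → iIndepFun X P →
      (∀ i, HasLaw (X i) μ P) → momentNorm 2 μ < ∞ → momentNorm q μ < ∞ → ∀ ε : ℝ, 0 < ε →
      ∃ A : Set Ω, MeasurableSet A ∧
        1 - C * (momentNorm q μ).toReal * (N : ℝ) ^ (-(1 / (d : ℝ))) / ε ≤ P.real A ∧
        ∀ ω ∈ A, wasserstein 2 μ (empiricalMeas fun i => X i ω) ≤ ENNReal.ofReal ε := by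
  obtain ⟨C, hC, h⟩ := exists_wasserstein_majorant hd hq
  -- Markov's inequality for the squared distance at level `ε ^ 2` gives failure probability at most
  -- `t ^ 2`, with `t` built from `√C`.
  refine ⟨√C, by positivity, fun P _ μ _ N X hN hind hX hμ2 hμq ε hε => ?_⟩
  obtain ⟨U, hU, hUint, hUle⟩ := h P μ N X hN hind hX hμ2 hμq
  set R := (momentNorm q μ).toReal
  set t := √C * R * (N : ℝ) ^ (-(1 / (d : ℝ))) / ε with ht
  have ht0 : 0 ≤ t := by positivity
  have hA0 : NullMeasurableSet {ω | U ω < ENNReal.ofReal (ε ^ 2)} P :=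
    nullMeasurableSet_lt hU aemeasurable_const
  -- The majorant `U` is only almost everywhere measurable, so the event is a measurable subset of
  -- full measure in its sublevel set.
  obtain ⟨A, hAsub, hAm, hAe⟩ := hA0.exists_measurable_subset_ae_eq
  refine ⟨A, hAm, ?_, fun ω hω => ?_⟩
  -- For `t ≥ 1` the claimed lower bound is nonpositive; for `t < 1`, `t ^ 2 ≤ t` yields the stated
  -- linear rate.
  · rcases le_or_gt 1 t with h1 | h1
    · linarith [(measureReal_nonneg : 0 ≤ P.real A)]
    have hmark : P {ω | ENNReal.ofReal (ε ^ 2) ≤ U ω} ≤ ENNReal.ofReal (t ^ 2) := by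
      refine (meas_ge_le_lintegral_div hU (by simpa using hε.ne') (by simp)).trans ?_
      refine (ENNReal.div_le_div_right hUint _).trans_eq ?_
      rw [← ENNReal.ofReal_div_of_pos (by positivity), ht]
      congr 1
      rw [div_pow, mul_pow, mul_pow, Real.sq_sqrt hC.le, ← Real.rpow_natCast (_ ^ _) 2,
        ← Real.rpow_mul (by positivity), mul_assoc]
      congr 4
      push_cast
      ring
    have hcompl : P.real Aᶜ ≤ t := by
      have : P Aᶜ = P {ω | ENNReal.ofReal (ε ^ 2) ≤ U ω} := by
        refine (measure_congr hAe.compl).trans ?_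
        congr 1
        ext ω
        simp
      rw [measureReal_def, this]
      refine ENNReal.toReal_le_of_le_ofReal ht0 (hmark.trans (ENNReal.ofReal_le_ofReal ?_))
      nlinarith
    have := probReal_add_probReal_compl (μ := P) hAm
    linarith
  · have h1 := (hUle ω).trans (hAsub hω).le
    rw [ENNReal.ofReal_pow hε.le] at h1
    exact (ENNReal.pow_le_pow_left_iff two_ne_zero).1 h1

end EmpiricalRate

/-! ### Main theorem -/

theorem mainTheorem3 (d : ℕ) (hd : 4 < d) (q : ℝ) (hq : 2 * (d : ℝ) / ((d : ℝ) - 2) < q) :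
    ∃ C : ℝ, 0 < C ∧
      ∀ (μ η : Measure (EuclideanSpace ℝ (Fin d))) [IsProbabilityMeasure μ]
        [IsProbabilityMeasure η],
      momentNorm q μ < ∞ →
      -- the model class, a subset of `L²(η)`
      ∀ 𝒯 : Set (EuclideanSpace ℝ (Fin d) → EuclideanSpace ℝ (Fin d)),
      (∀ T ∈ 𝒯, MemLp T 2 η) →
      -- the ground truth map, which transports `η` to `μ`
      ∀ Tdag : EuclideanSpace ℝ (Fin d) → EuclideanSpace ℝ (Fin d),
      MemLp Tdag 2 η → η.map Tdag = μ →
      -- a best approximation of the ground truth map in the model class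
      ∀ TdagHat ∈ argminOn (fun T => eLpNorm (T - Tdag) 2 η) 𝒯,
      -- `N` independent samples from `μ`
      ∀ {Ω : Type*} [MeasurableSpace Ω] (P : Measure Ω) [IsProbabilityMeasure P]
        (N : ℕ) (X : Fin N → Ω → EuclideanSpace ℝ (Fin d)),
      0 < N → iIndepFun X P → (∀ i, HasLaw (X i) μ P) →
      ∀ ε : ℝ, 0 < ε →
      ∃ A : Set Ω, MeasurableSet A ∧
        1 - C * (momentNorm q μ).toReal * (N : ℝ) ^ (-(1 / (d : ℝ))) / ε ≤ P.real A ∧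
        ∀ ω ∈ A,
          ∀ TN ∈ argminOn
            (fun T => wasserstein 2 (η.map T) (empiricalMeas (fun i => X i ω))) 𝒯,
          wasserstein 2 μ (η.map TN) ≤ eLpNorm (TdagHat - Tdag) 2 η + ENNReal.ofReal ε := by
  obtain ⟨C, hC, h⟩ := exists_event_wasserstein_le hd hq
  refine ⟨2 * C, by positivity, fun μ η _ _ hμ 𝒯 h𝒯 Tdag hTdag hmap TdagHat hhat Ω _ P _ N X hN
    hind hX ε hε => ?_⟩
  -- The level `ε / 2` offsets the factor `2` in front of `δ` in `wasserstein_argmin_le`, and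
  -- doubles the constant. The second moment of `μ` is finite because `Tdag` lies in `L²(η)`.
  obtain ⟨A, hAm, hA, hAle⟩ := h P μ N X hN hind hX (hmap ▸ momentNorm_map_lt_top hTdag) hμ (ε / 2)
    (by positivity)
  refine ⟨A, hAm, le_of_eq_of_le ?_ hA, fun ω hω TN hTN => ?_⟩
  · field_simp
  · have h1 := wasserstein_argmin_le h𝒯 hTdag hhat.1 hTN
      (δ := ENNReal.ofReal (ε / 2)) (by rw [hmap]; exact hAle ω hω)
    rw [hmap] at h1
    refine h1.trans_eq ?_
    congr 1
    rw [show (2 : ℝ≥0∞) = ENNReal.ofReal 2 by simp, ← ENNReal.ofReal_mul (by norm_num)]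
    congr 1
    ring
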